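/- **Setting.** Let $\mathcal X\subset\mathbb R^d$ be closed, convex and bounded, with Euclidean diameter $D$; let $T\ge 2$ and $G>0$. For $t=1,\dots,T$ let the cost functions $f_t:\mathcal X\to\mathbb R$ and the constraint functions $g_t:\mathcal X\to\mathbb R$ be convex and $G$-Lipschitz. Put $S_0=\mathcal X$ and $S_t=\{x\in\mathcal X: g_\tau(x)\le 0,\ 1\le\tau\le t\}$, and assume $\mathcal X^\star:=S_T\neq\varnothing$. Write $(z)^+=\max(z,0)$, let $\mathcal P_K$ be the Euclidean projection onto $K$, and for actions $x_1,\dots,x_T$ put $$\mathrm{CCV}_{[1:t]}=\sum_{\tau=1}^t (g_\tau(x_\tau))^+,\qquad \mathrm{Regret}_{[1:T]}(x^\star)=\sum_{t=1}^T f_t(x_t)-\sum_{t=1}^T f_t(x^\star)\quad(x^\star\in\mathcal X^\star).$$ A symbol $\nabla\varphi(x)$ below stands for any subgradient at $x$ of the convex function $\varphi:\mathcal X\to\mathbb R$ whose norm is at most the Lipschitz constant of $\varphi$ that is inherited from $G$ ($G$ for $f_t$; $\beta G(1+\Phi'(Q_t))$ for $\hat f_t$). **Algorithm Switch.** Start from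 an arbitrary $x_1\in\mathcal X$. A round $t$ belongs to the *first phase* if $\mathrm{CCV}_{[1:t-1]}\le\sqrt T\log T$, and to the *second phase* otherwise; once left, the first phase is left for good. * First phase (Algorithm 2): play $x_t$, set $y_t=\mathcal P_{S_{t-1}}\big(x_t-\tfrac{D}{G\sqrt t}\nabla f_t(x_t)\big)$ and $x_{t+1}=\mathcal P_{S_t}(y_t)$. * Second phase (the algorithm of Sinha 2024, started afresh from an arbitrary point of $\mathcal X$): with $\beta=(2GD)^{-1}$, $\lambda=\frac1{2\sqrt T}$, $\Phi(q)=e^{\lambda q}-1$, and $Q_t=\sum_\tau\beta (g_\tau(x_\tau))^+$, where the sum is over the rounds $\tau\le t$ of the second phase, play $x_t$, put $\hat f_t=\beta f_t+\Phi'(Q_t)\,\beta (g_t)^+$ and $\nabla_t=\nabla\hat f_t(x_t)$, and set $x_{t+1}=\mathcal P_{\mathcal X}(x_t-\eta_t\nabla_t)$ with $\eta_t=\frac{\sqrt2 D}{2\sqrt{\sum_\tau\|\nabla_\tau\|^2}}$, where the sum is over the same rounds. **The constant $c^\star$.** For a round $t$ of the first phase with $x_t\notin S_t$ let $b_t=\mathcal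 P_{S_t}(x_t)$ and $m_t=\frac{x_t+b_t}2$, and let $c_t^\star$ be the supremum of all $c>0$ such that, for some unit vector $w$, the convex hull of $\{m_t\}\cup S_t$ lies in the cone $\{z:-w^{\mathsf T}(z-m_t)\ge c\,\|z-m_t\|\}$; that is, $c_t^\star$ is the cosine of the half-angle of the narrowest such cone. Let $c^\star\in(0,1]$ be the minimum of $c_t^\star$ over these rounds ($c^\star=1$ if there are none). **Theorem.** There is an absolute constant $C>0$ such that, for all $d$, all $T\ge2$, all such instances and all runs of Switch on them, $$\mathrm{Regret}_{[1:T]}(x^\star)\le C\,GD\sqrt T\quad\text{for all }x^\star\in\mathcal X^\star,$$ $$\mathrm{CCV}_{[1:T]}\le \min\Big\{C(1+GD)\,G\,\sqrt d\,\Big(\frac1{c^\star}\Big)^{d}D,\ \ C(1+GD)\,\sqrt T\log T\Big\}.$$ In particular, for fixed $G$ and $D$, the regret is $O(\sqrt T)$ and the CCV is the minimum of $O\big(\sqrt d\,(1/c^\star)^dD\big)$ and $O(\sqrt T\log T)$. -/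

import Mathlib

noncomputable section

/-- The data of a constrained online convex optimization problem in `ℝ^d`: the horizon `T`, the
Lipschitz constant `G`, the admissible set `X`, and the cost functions `f t` and constraint
functions `g t`, `t = 1, …, T`. Only the values of `f t`, `g t` on `X` are ever used. -/
structure COCO (d : ℕ) where
  T : ℕ
  G : ℝ
  X : Set (EuclideanSpace ℝ (Fin d))
  f : ℕ → EuclideanSpace ℝ (Fin d) → ℝ
  g : ℕ → EuclideanSpace ℝ (Fin d) → ℝ

/-- `y` is a Euclidean projection of `x` onto `K`: a point of `K` nearest to `x`. -/
def IsProj {d : ℕ} (K : Set (EuclideanSpace ℝ (Fin d))) (x y : EuclideanSpace ℝ (Fin d)) : Prop :=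
  y ∈ K ∧ ∀ z ∈ K, ‖x - y‖ ≤ ‖x - z‖

/-- `p` is a subgradient at `x` of `φ : X → ℝ`, of norm at most `L`. When `φ` is `L`-Lipschitz and
differentiable at an interior point `x` of `X`, the gradient is such a `p`, and the only one. -/
def IsSubgrad {d : ℕ} (X : Set (EuclideanSpace ℝ (Fin d))) (φ : EuclideanSpace ℝ (Fin d) → ℝ)
    (L : ℝ) (x p : EuclideanSpace ℝ (Fin d)) : Prop :=
  ‖p‖ ≤ L ∧ ∀ z ∈ X, φ x + inner ℝ p (z - x) ≤ φ z

/-- The cone with apex `m` (apex included) of all `z` with `-wᵀ (z - m) / ‖z - m‖ ≥ c`. -/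
def apexCone {d : ℕ} (m w : EuclideanSpace ℝ (Fin d)) (c : ℝ) : Set (EuclideanSpace ℝ (Fin d)) :=
  {z | c * ‖z - m‖ ≤ - inner ℝ w (z - m)}

/-- The cosine of the half-angle of the narrowest cone `apexCone m w c`, `‖w‖ = 1`, `c > 0`, that
contains `conv ({m} ∪ K)`. A narrower cone has a larger `c`. -/
def coneCos {d : ℕ} (m : EuclideanSpace ℝ (Fin d)) (K : Set (EuclideanSpace ℝ (Fin d))) : ℝ :=
  sSup {c : ℝ | 0 < c ∧ ∃ w : EuclideanSpace ℝ (Fin d), ‖w‖ = 1 ∧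
    convexHull ℝ (insert m K) ⊆ apexCone m w c}

namespace COCO

variable {d : ℕ} (P : COCO d)

/-- The Euclidean diameter of the admissible set. -/
def D : ℝ := Metric.diam P.X

/-- `S_t`, the set of admissible actions that satisfy the constraints of rounds `1, …, t`;
`S_0 = X`. -/
def S (t : ℕ) : Set (EuclideanSpace ℝ (Fin d)) :=
  {z | z ∈ P.X ∧ ∀ s ∈ Finset.Icc 1 t, P.g s z ≤ 0}

/-- The standing assumptions: convexity, boundedness, Lipschitz continuity and feasibility. -/
structure Standing : Prop where
  G_pos : 0 < P.G
  closed : IsClosed P.X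
  convex : Convex ℝ P.X
  bounded : Bornology.IsBounded P.X
  convex_f : ∀ t ∈ Finset.Icc 1 P.T, ConvexOn ℝ P.X (P.f t)
  convex_g : ∀ t ∈ Finset.Icc 1 P.T, ConvexOn ℝ P.X (P.g t)
  lipschitz_f : ∀ t ∈ Finset.Icc 1 P.T, ∀ x ∈ P.X, ∀ y ∈ P.X,
    |P.f t x - P.f t y| ≤ P.G * ‖x - y‖
  lipschitz_g : ∀ t ∈ Finset.Icc 1 P.T, ∀ x ∈ P.X, ∀ y ∈ P.X,
    |P.g t x - P.g t y| ≤ P.G * ‖x - y‖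
  feasible : (P.S P.T).Nonempty

/-- The regret of the actions `x 1, …, x T` against the fixed action `u`. -/
def regret (x : ℕ → EuclideanSpace ℝ (Fin d)) (u : EuclideanSpace ℝ (Fin d)) : ℝ :=
  ∑ t ∈ Finset.Icc 1 P.T, P.f t (x t) - ∑ t ∈ Finset.Icc 1 P.T, P.f t u

/-- The cumulative constraint violation of the actions `x 1, …, x t`. -/
def ccv (x : ℕ → EuclideanSpace ℝ (Fin d)) (t : ℕ) : ℝ :=
  ∑ s ∈ Finset.Icc 1 t, max (P.g s (x s)) 0

/-- In round `t` the algorithm is still in its first phase: the violation accumulated before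
round `t` is at most `√T log T`. As `ccv` is nondecreasing in `t`, once the first phase has been
left it is left for good. -/
def FirstPhase (x : ℕ → EuclideanSpace ℝ (Fin d)) (t : ℕ) : Prop :=
  P.ccv x (t - 1) ≤ √(P.T : ℝ) * Real.log P.T

/-- The parameter `β = (2 G D)⁻¹` of the second phase. -/
def β : ℝ := (2 * P.G * P.D)⁻¹

/-- The potential `Φ(q) = exp(λ q) - 1`, `λ = 1 / (2 √T)`, of the second phase. -/
def Φ (q : ℝ) : ℝ := Real.exp (1 / (2 * √(P.T : ℝ)) * q) - 1

open Classical in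
/-- The scaled violation counter of the second phase, which starts from `0` at the switch. -/
def scaledCCV (x : ℕ → EuclideanSpace ℝ (Fin d)) (t : ℕ) : ℝ :=
  ∑ s ∈ Finset.Icc 1 t with ¬ P.FirstPhase x s, P.β * max 0 (P.g s (x s))

/-- The surrogate cost `β f_t + Φ'(CCV(t)) β (g_t)⁺` of round `t` in the second phase. -/
def surrogate (x : ℕ → EuclideanSpace ℝ (Fin d)) (t : ℕ) (z : EuclideanSpace ℝ (Fin d)) : ℝ :=
  P.β * P.f t z + deriv P.Φ (P.scaledCCV x t) * (P.β * max 0 (P.g t z))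

/-- The Lipschitz constant on `X` of the surrogate cost. -/
def surrogateLip (x : ℕ → EuclideanSpace ℝ (Fin d)) (t : ℕ) : ℝ :=
  P.β * P.G + deriv P.Φ (P.scaledCCV x t) * (P.β * P.G)

open Classical in
/-- The adaptive step size `√2 D / (2 √(∑ ‖∇_s‖²))` of the second phase; the sum is over the rounds
of the second phase up to `t`. (If the sum is `0`, then so is the step, whatever its size.) -/
def adaptiveStep (x p : ℕ → EuclideanSpace ℝ (Fin d)) (t : ℕ) : ℝ :=
  √2 * P.D / (2 * √(∑ s ∈ Finset.Icc 1 t with ¬ P.FirstPhase x s, ‖p s‖ ^ 2))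

/-- `x 1, x 2, …` are actions of algorithm Switch on the instance `P`, with intermediate points
`y t` in the first phase and (sub)gradients `p t`.

First phase: a gradient step for `f t` of size `D / (G √t)`, projected onto `S (t-1)`, gives `y t`,
whose projection onto `S t` is the next action. Second phase: a gradient step for the surrogate
cost, of adaptive size, projected onto `X`. The first action of either phase is an arbitrary
admissible one (so the second phase may start from a fixed point of `X`, or continue from the
point that the last step of the first phase would have given). -/
structure IsSwitchRun (x y p : ℕ → EuclideanSpace ℝ (Fin d)) : Prop where
  init : x 1 ∈ P.X
  grad_first : ∀ t ∈ Finset.Icc 1 P.T, P.FirstPhase x t →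
    IsSubgrad P.X (P.f t) P.G (x t) (p t)
  step_first : ∀ t ∈ Finset.Icc 1 P.T, P.FirstPhase x t →
    IsProj (P.S (t - 1)) (x t - (P.D / (P.G * √(t : ℝ))) • p t) (y t)
  next_first : ∀ t ∈ Finset.Icc 1 P.T, P.FirstPhase x t → P.FirstPhase x (t + 1) →
    IsProj (P.S t) (y t) (x (t + 1))
  switch : ∀ t ∈ Finset.Icc 1 P.T, P.FirstPhase x t → ¬ P.FirstPhase x (t + 1) →
    x (t + 1) ∈ P.X
  grad_second : ∀ t ∈ Finset.Icc 1 P.T, ¬ P.FirstPhase x t →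
    IsSubgrad P.X (P.surrogate x t) (P.surrogateLip x t) (x t) (p t)
  step_second : ∀ t ∈ Finset.Icc 1 P.T, ¬ P.FirstPhase x t →
    IsProj P.X (x t - P.adaptiveStep x p t • p t) (x (t + 1))

/-- `c⋆ = min_t c_t⋆` over the rounds `t` of the first phase with `x t ∉ S t`, where `c_t⋆` is the
cosine of the half-angle of the narrowest cone with apex `m_t` that contains
`conv ({m_t} ∪ S t)`, and `m_t` is the midpoint of `x t` and its projection `b` onto `S t`.
Always `c_t⋆ ≤ 1`, so that the extra element `1` only serves to make `c⋆ = 1` if there are no such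
rounds. -/
def cStar (x : ℕ → EuclideanSpace ℝ (Fin d)) : ℝ :=
  sInf (insert 1 {c : ℝ | ∃ t ∈ Finset.Icc 1 P.T, P.FirstPhase x t ∧ x t ∉ P.S t ∧
    ∃ b, IsProj (P.S t) (x t) b ∧ c = coneCos (midpoint ℝ (x t) b) (P.S t)})

end COCO

end

/-!
The violation of the first phase is controlled by the Gaussian mean width
`W(K) = 𝔼 sup_{z ∈ K} ⟨u, z - o⟩`, `u` a standard Gaussian vector, of the nested sets `S t`. If the
action `x ∈ S (t-1)` is at distance `‖x - b‖` from `S t` and `m` is the midpoint of `x` and its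
projection `b`, let a cone with apex `m`, axis `-w` and cosine `c` contain `S t`. In every
direction `u` of the dual cone around `w` the support function of `S t` is at most that of `m`,
so that it drops by at least `⟨u, x - m⟩`. By symmetry, `u` integrates over the dual cone to a
multiple of `w`; integrating along `w` first, and then over the orthogonal complement, gives
exactly `c ^ (d-1) / √(2π)` for that multiple (`integral_axisCone_inner`). As `b` itself lies in
the cone, `⟨w, x - m⟩ ≥ c ‖x - b‖ / 2`, and the mean width drops by at least
`c ^ d ‖x - b‖ / (2 √(2π))` (`gaussianWidth_drop`). The width starts from at most `D √d` and stays
nonnegative, so the distances, and with them the violations, sum to `O(√d (1 / c) ^ d D)`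
(`COCO.IsSwitchRun.ccv_le_of_firstPhase`). No constant exponential in `d` is lost because the
dual cone is integrated over in full.

The regret of the first phase is that of projected gradient descent; the additional projections
onto sets that contain the comparator only help (`COCO.IsSwitchRun.regret_first`). In the second
phase the adaptive step sizes give a surrogate regret of `√2 D √(∑ ‖∇‖²)`, while the surrogate
regret dominates the scaled regret plus the potential `exp (λ Q) - 1` of the scaled violation `Q`.
With `λ = 1 / (2 √T)` this becomes `exp (λ Q) / 2 + β · regret ≤ 1 + √T`
(`COCO.IsSwitchRun.exp_add_regret_le`), which bounds the regret by `O(G D √T)`, and, since the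
regret is at least `-G D T`, bounds `Q` by `O(√T log T)`.

Finally, if the algorithm switches, then the violation of its first phase exceeds `√T log T`.
Hence the bound by `c⋆` on the first phase also bounds `√T log T`, and the violation of the second
phase with it (`COCO.IsSwitchRun.ccv_le_cStar`).
-/

section

open MeasureTheory ProbabilityTheory

/-! ### Gaussian moments of a cone -/

theorem integral_Ioi_mul_exp_neg_sq_half (b : ℝ) :
    ∫ s in Set.Ioi b, s * Real.exp (-s ^ 2 / 2) = Real.exp (-b ^ 2 / 2) := by
  have hderiv : ∀ s : ℝ, HasDerivAt (fun s : ℝ => -Real.exp (-s ^ 2 / 2))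
      (s * Real.exp (-s ^ 2 / 2)) s := by
    intro s
    have h : HasDerivAt (fun s : ℝ => -s ^ 2 / 2) (-s) s :=
      (((hasDerivAt_pow 2 s).neg).div_const 2).congr_deriv (by norm_num; ring)
    exact h.exp.neg.congr_deriv (by ring)
  have hint : Integrable (fun s : ℝ => s * Real.exp (-s ^ 2 / 2)) := by
    have := integrable_mul_exp_neg_mul_sq (b := 1 / 2) (by norm_num)
    refine this.congr (Filter.Eventually.of_forall fun s => ?_)
    simp only
    congr 2
    ring
  have hlim : Filter.Tendsto (fun s : ℝ => -Real.exp (-s ^ 2 / 2)) Filter.atTop (nhds (-0)) := by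
    refine Filter.Tendsto.neg (Real.tendsto_exp_atBot.comp ?_)
    have h2 : Filter.Tendsto (fun s : ℝ => s ^ 2 / 2) Filter.atTop Filter.atTop :=
      (Filter.tendsto_pow_atTop two_ne_zero).atTop_div_const (by norm_num)
    refine (Filter.tendsto_neg_atTop_atBot.comp h2).congr fun s => ?_
    simp only [Function.comp]
    ring
  rw [integral_Ioi_of_hasDerivAt_of_tendsto (hderiv b).continuousAt.continuousWithinAt
    (fun s _ => hderiv s) hint.integrableOn hlim]
  ring

theorem integral_indicator_Ici_id_gaussianReal (b : ℝ) :
    ∫ s, (Set.Ici b).indicator id s ∂(gaussianReal 0 1) =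
      (√(2 * Real.pi))⁻¹ * Real.exp (-b ^ 2 / 2) := by
  rw [integral_gaussianReal_eq_integral_smul one_ne_zero, ← integral_Ioi_mul_exp_neg_sq_half,
    ← integral_Ici_eq_integral_Ioi, ← integral_const_mul, ← integral_indicator measurableSet_Ici]
  congr 1
  ext s
  by_cases hs : s ∈ Set.Ici b
  · simp [Set.indicator_of_mem hs, gaussianPDFReal]
    ring
  · simp [Set.indicator_of_notMem hs]

theorem integral_exp_neg_sq_gaussianReal (a : ℝ) :
    ∫ s, Real.exp (-(a * s) ^ 2 / 2) ∂(gaussianReal 0 1) = (√(1 + a ^ 2))⁻¹ := by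
  rw [integral_gaussianReal_eq_integral_smul one_ne_zero]
  have h : ∀ s : ℝ, gaussianPDFReal 0 1 s • Real.exp (-(a * s) ^ 2 / 2) =
      (√(2 * Real.pi))⁻¹ * Real.exp (-((1 + a ^ 2) / 2) * s ^ 2) := by
    intro s
    simp only [gaussianPDFReal, smul_eq_mul, NNReal.coe_one, mul_one, sub_zero]
    rw [mul_assoc, ← Real.exp_add]
    congr 2
    ring
  simp_rw [h]
  rw [integral_const_mul, integral_gaussian, ← Real.sqrt_inv, ← Real.sqrt_inv, ← Real.sqrt_mul]
  · congr 1
    have := Real.pi_pos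
    field_simp
  · positivity

section

variable {E : Type*} [NormedAddCommGroup E] [InnerProductSpace ℝ E]

/-- The cone around the unit vector `w` of all `u` whose component orthogonal to `w`, scaled by `a`,
is at most as long as their (nonnegative) component along `w`. The cotangent of its half-angle is
`a`. -/
def axisCone (w : E) (a : ℝ) : Set E := {u | a * ‖u - inner ℝ w u • w‖ ≤ inner ℝ w u}

theorem isClosed_axisCone (w : E) (a : ℝ) : IsClosed (axisCone w a) :=
  isClosed_le (by fun_prop) (by fun_prop)

variable [FiniteDimensional ℝ E] [MeasurableSpace E] [BorelSpace E]

theorem integrable_inner_stdGaussian (v : E) :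
    Integrable (fun u => inner ℝ v u) (stdGaussian E) :=
  (IsGaussian.integrable_id (μ := stdGaussian E)).const_inner v

theorem integral_norm_sq_stdGaussian :
    ∫ u, ‖u‖ ^ 2 ∂(stdGaussian E) = Module.finrank ℝ E := by
  have hm : ∀ v : E, MemLp (fun u => inner ℝ v u) 2 (stdGaussian E) := fun v =>
    (IsGaussian.memLp_two_id (μ := stdGaussian E)).const_inner v
  have h : ∀ v : E, ∫ u, (inner ℝ v u) ^ 2 ∂(stdGaussian E) = ‖v‖ ^ 2 := by
    intro v
    have h1 := variance_dual_stdGaussian (E := E) (innerSL ℝ v)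
    rw [variance_of_integral_eq_zero (by fun_prop) (integral_strongDual_stdGaussian _),
      innerSL_apply_norm] at h1
    simpa using h1
  simp_rw [← fun u : E => (stdOrthonormalBasis ℝ E).sum_sq_norm_inner_right u, Real.norm_eq_abs,
    sq_abs]
  rw [integral_finsetSum _ fun i _ => (hm _).integrable_sq]
  simp [h]

theorem integral_norm_stdGaussian_le :
    ∫ u, ‖u‖ ∂(stdGaussian E) ≤ √(Module.finrank ℝ E : ℝ) := by
  have h2 : MemLp (fun u : E => ‖u‖) 2 (stdGaussian E) :=
    (IsGaussian.memLp_two_id (μ := stdGaussian E)).norm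
  have hv := variance_nonneg (fun u : E => ‖u‖) (stdGaussian E)
  rw [variance_eq_sub h2] at hv
  apply Real.le_sqrt_of_sq_le
  rw [← integral_norm_sq_stdGaussian (E := E)]
  simpa using hv

/-- The Gaussian moment of a cone along its axis. The component along the axis is integrated out
first, which leaves a product of one-dimensional Gaussian integrals. -/
theorem integral_axisCone_inner_axis {n : ℕ} (hn : Module.finrank ℝ E = n + 1) {w : E}
    (hw : ‖w‖ = 1) (a : ℝ) :
    ∫ u, (axisCone w a).indicator (fun u => inner ℝ w u) u ∂(stdGaussian E) =
      (√(2 * Real.pi))⁻¹ * (√(1 + a ^ 2))⁻¹ ^ n := by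
  obtain ⟨b, hb⟩ : ∃ b : OrthonormalBasis (Fin (n + 1)) ℝ E, ∀ i ∈ ({0} : Set (Fin (n + 1))),
      b i = w := by
    refine Orthonormal.exists_orthonormalBasis_extension_of_card_eq (v := fun _ => w)
      (by simp [hn]) ?_
    rw [orthonormal_iff_ite]
    intro i j
    have hij : i = j := Subsingleton.elim _ _
    simp [hij, hw]
  have hb0 : b 0 = w := hb 0 rfl
  set γ := gaussianReal 0 1
  have hF : ∀ x : Fin (n + 1) → ℝ,
      (axisCone w a).indicator (fun u => inner ℝ w u) (∑ i, x i • b i) =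
      (Set.Ici (a * √(∑ i : Fin n, x i.succ ^ 2))).indicator id (x 0) := by
    intro x
    have h0 : inner ℝ w (∑ i, x i • b i) = x 0 := by
      rw [← hb0, b.orthonormal.inner_right_fintype]
    have h1 : ‖(∑ i, x i • b i) - x 0 • w‖ = √(∑ i : Fin n, x i.succ ^ 2) := by
      rw [Fin.sum_univ_succ, hb0, add_sub_cancel_left]
      have ho : Orthonormal ℝ (fun i : Fin n => b i.succ) :=
        b.orthonormal.comp _ (Fin.succ_injective n)
      rw [norm_eq_sqrt_real_inner, ho.inner_sum]
      simp [sq]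
    simp only [Set.indicator, axisCone, Set.mem_ofPred_eq, Set.mem_Ici, h0, h1, id]
  have hmeas : MeasurableSet {p : ℝ × (Fin n → ℝ) | a * √(∑ i, p.2 i ^ 2) ≤ p.1} :=
    measurableSet_le (by fun_prop) (by fun_prop)
  rw [stdGaussian_eq_map_pi_orthonormalBasis b, integral_map
    (Measurable.aemeasurable (by fun_prop))
    (((by fun_prop : Measurable fun u : E => inner ℝ w u).indicator
      (isClosed_axisCone w a).measurableSet).aestronglyMeasurable)]
  simp_rw [hF]
  have hmp := measurePreserving_piFinSuccAbove (fun _ : Fin (n + 1) => γ) 0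
  have h2 := hmp.integral_comp' (fun p : ℝ × (Fin n → ℝ) =>
    (Set.Ici (a * √(∑ i, p.2 i ^ 2))).indicator id p.1)
  have h3 : ∀ x : Fin (n + 1) → ℝ, (Set.Ici (a * √(∑ i : Fin n, x i.succ ^ 2))).indicator id (x 0)
      = (fun p : ℝ × (Fin n → ℝ) => (Set.Ici (a * √(∑ i, p.2 i ^ 2))).indicator id p.1)
        (MeasurableEquiv.piFinSuccAbove (fun _ => ℝ) 0 x) := by
    intro x
    simp [MeasurableEquiv.piFinSuccAbove, Fin.tail]
  simp_rw [h3]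
  rw [h2, integral_prod_symm]
  · simp_rw [γ, integral_indicator_Ici_id_gaussianReal]
    rw [integral_const_mul]
    congr 1
    have h4 : ∀ y : Fin n → ℝ, Real.exp (-(a * √(∑ i, y i ^ 2)) ^ 2 / 2) =
        ∏ i, Real.exp (-(a * y i) ^ 2 / 2) := by
      intro y
      rw [← Real.exp_sum, mul_pow, Real.sq_sqrt (Finset.sum_nonneg fun i _ => sq_nonneg _),
        Finset.mul_sum, ← Finset.sum_div, Finset.sum_neg_distrib]
      simp_rw [mul_pow]
    simp_rw [h4]
    rw [integral_fintype_prod_eq_prod (fun _ : Fin n => fun s : ℝ => Real.exp (-(a * s) ^ 2 / 2))]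
    simp [integral_exp_neg_sq_gaussianReal]
  · have hi : Integrable (fun p : ℝ × (Fin n → ℝ) => p.1) (γ.prod (Measure.pi fun _ => γ)) :=
      (IsGaussian.integrable_id (μ := γ)).comp_fst _
    exact hi.indicator hmeas

/-- By the symmetry of the cone about its axis, its Gaussian moment points along the axis. -/
theorem integral_axisCone_inner {n : ℕ} (hn : Module.finrank ℝ E = n + 1) {w : E}
    (hw : ‖w‖ = 1) (a : ℝ) (v : E) :
    ∫ u, (axisCone w a).indicator (fun u => inner ℝ v u) u ∂(stdGaussian E) =
      (√(2 * Real.pi))⁻¹ * (√(1 + a ^ 2))⁻¹ ^ n * inner ℝ w v := by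
  set R := (ℝ ∙ w).reflection with hR
  have hRu : ∀ u, R u = 2 • inner ℝ w u • w - u := by
    intro u
    rw [hR, Submodule.reflection_singleton_apply]
    simp [hw]
  have hww : inner ℝ w w = 1 := by simp [hw]
  have hwR : ∀ u, inner ℝ w (R u) = inner ℝ w u := by
    intro u
    rw [hRu, inner_sub_right, two_smul, inner_add_right, inner_smul_right, hww]
    ring
  have hcone : ∀ u, R u ∈ axisCone w a ↔ u ∈ axisCone w a := by
    intro u
    simp only [axisCone, Set.mem_ofPred_eq, hwR]
    have : R u - inner ℝ w u • w = -(u - inner ℝ w u • w) := by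
      rw [hRu, two_smul]; abel
    rw [this, norm_neg]
  have hmeas : ∀ v : E, Integrable ((axisCone w a).indicator (fun u => inner ℝ v u))
      (stdGaussian E) := fun v =>
    (integrable_inner_stdGaussian v).indicator (isClosed_axisCone w a).measurableSet
  have hsym : ∫ u, (axisCone w a).indicator (fun u => inner ℝ v u) (R u) ∂(stdGaussian E) =
      ∫ u, (axisCone w a).indicator (fun u => inner ℝ v u) u ∂(stdGaussian E) := by
    conv_rhs => rw [← stdGaussian_map R]
    rw [integral_map (by fun_prop)]
    rw [stdGaussian_map R]
    exact (hmeas v).aestronglyMeasurable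
  have hsum : ∀ u, (axisCone w a).indicator (fun u => inner ℝ v u) (R u) +
      (axisCone w a).indicator (fun u => inner ℝ v u) u =
      (2 * inner ℝ w v) * (axisCone w a).indicator (fun u => inner ℝ w u) u := by
    intro u
    by_cases hu : u ∈ axisCone w a
    · rw [Set.indicator_of_mem hu, Set.indicator_of_mem hu, Set.indicator_of_mem ((hcone u).2 hu),
        hRu, inner_sub_right, two_smul, inner_add_right, inner_smul_right, real_inner_comm v w]
      ring
    · rw [Set.indicator_of_notMem hu, Set.indicator_of_notMem hu,
        Set.indicator_of_notMem (mt (hcone u).1 hu)]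
      ring
  have hRi : Integrable (fun u => (axisCone w a).indicator (fun u => inner ℝ v u) (R u))
      (stdGaussian E) := by
    have := (hmeas v)
    rw [← stdGaussian_map R] at this
    exact this.comp_measurable (by fun_prop)
  have h := integral_add hRi (hmeas v)
  simp_rw [hsum] at h
  rw [integral_const_mul, integral_axisCone_inner_axis hn hw a, hsym] at h
  linarith

end

/-! ### The Gaussian mean width -/

section

variable {E : Type*} [NormedAddCommGroup E] [InnerProductSpace ℝ E]

/-- The support function of `K`, with `o` taken as the origin. -/
noncomputable def supportFn (o : E) (K : Set E) (u : E) : ℝ :=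
  sSup ((fun z => inner ℝ u (z - o)) '' K)

theorem inner_le_supportFn {o : E} {K : Set E} (hK : IsCompact K) {z : E} (hz : z ∈ K) (u : E) :
    inner ℝ u (z - o) ≤ supportFn o K u :=
  le_csSup (hK.image (by fun_prop)).bddAbove ⟨z, hz, rfl⟩

theorem supportFn_le {o : E} {K : Set E} (hK : K.Nonempty) {u : E} {r : ℝ}
    (h : ∀ z ∈ K, inner ℝ u (z - o) ≤ r) : supportFn o K u ≤ r :=
  csSup_le (hK.image _) (by rintro _ ⟨z, hz, rfl⟩; exact h z hz)

theorem supportFn_mono {o : E} {K L : Set E} (hL : IsCompact L) (hK : K.Nonempty) (h : K ⊆ L)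
    (u : E) : supportFn o K u ≤ supportFn o L u :=
  supportFn_le hK fun _ hz => inner_le_supportFn hL (h hz) u

theorem continuous_supportFn (o : E) {K : Set E} (hK : IsCompact K) :
    Continuous (supportFn o K) :=
  hK.continuous_sSup (f := fun u z => inner ℝ u (z - o)) (by
    simp only [Function.HasUncurry.uncurry, id]
    fun_prop)

theorem abs_supportFn_le {o : E} {K : Set E} (hK : IsCompact K) (hne : K.Nonempty) {r : ℝ}
    (hr : ∀ z ∈ K, ‖z - o‖ ≤ r) (u : E) : |supportFn o K u| ≤ r * ‖u‖ := by
  have h : ∀ z ∈ K, |inner ℝ u (z - o)| ≤ r * ‖u‖ := fun z hz =>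
    (abs_real_inner_le_norm u (z - o)).trans (by
      rw [mul_comm]
      exact mul_le_mul_of_nonneg_right (hr z hz) (norm_nonneg u))
  rw [abs_le]
  refine ⟨?_, supportFn_le hne fun z hz => (abs_le.1 (h z hz)).2⟩
  obtain ⟨z, hz⟩ := hne
  exact (abs_le.1 (h z hz)).1.trans (inner_le_supportFn hK hz u)

variable [FiniteDimensional ℝ E] [MeasurableSpace E]

/-- The Gaussian mean width of `K`: the mean of its support function, with origin `o`, in a
standard Gaussian direction. -/
noncomputable def gaussianWidth (o : E) (K : Set E) : ℝ := ∫ u, supportFn o K u ∂(stdGaussian E)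

theorem gaussianWidth_nonneg {o : E} {K : Set E} (hK : IsCompact K) (ho : o ∈ K) :
    0 ≤ gaussianWidth o K :=
  integral_nonneg fun u => by simpa using inner_le_supportFn (o := o) hK ho u

variable [BorelSpace E]

theorem integrable_supportFn (o : E) {K : Set E} (hK : IsCompact K) (hne : K.Nonempty) :
    Integrable (supportFn o K) (stdGaussian E) := by
  obtain ⟨r, hr⟩ := (hK.image (f := fun z => ‖z - o‖) (by fun_prop)).bddAbove
  refine Integrable.mono' (((IsGaussian.integrable_id (μ := stdGaussian E)).norm).const_mul r)
    (continuous_supportFn o hK).aestronglyMeasurable (Filter.Eventually.of_forall fun u => ?_)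
  exact abs_supportFn_le hK hne (fun z hz => hr ⟨z, hz, rfl⟩) u

theorem gaussianWidth_le {o : E} {K : Set E} (hK : IsCompact K) (hne : K.Nonempty) {r : ℝ}
    (hr₀ : 0 ≤ r) (hr : ∀ z ∈ K, ‖z - o‖ ≤ r) :
    gaussianWidth o K ≤ r * √(Module.finrank ℝ E : ℝ) := by
  calc gaussianWidth o K ≤ ∫ u, r * ‖u‖ ∂(stdGaussian E) :=
        integral_mono (integrable_supportFn o hK hne)
          (((IsGaussian.integrable_id (μ := stdGaussian E)).norm).const_mul r)
          fun u => (le_abs_self _).trans (abs_supportFn_le hK hne hr u)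
    _ = r * ∫ u, ‖u‖ ∂(stdGaussian E) := integral_const_mul _ _
    _ ≤ _ := mul_le_mul_of_nonneg_left integral_norm_stdGaussian_le hr₀

theorem gaussianWidth_mono {o : E} {K L : Set E} (hK : IsCompact K) (hL : IsCompact L)
    (hne : K.Nonempty) (h : K ⊆ L) : gaussianWidth o K ≤ gaussianWidth o L :=
  integral_mono (integrable_supportFn o hK hne) (integrable_supportFn o hL (hne.mono h))
    (supportFn_mono hL hne h)

end

/-! ### The drop of the mean width -/

/-- A cone of half-angle `θ`, `cos θ = c`, lies in the polar of the cone of half-angle `π / 2 - θ`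
around its outward axis. -/
theorem inner_nonpos_of_mem_axisCone {d : ℕ} {m w u z : EuclideanSpace ℝ (Fin d)} {c : ℝ}
    (hw : ‖w‖ = 1) (hc : 0 < c) (hc1 : c ≤ 1) (hu : u ∈ axisCone w (√(1 - c ^ 2) / c))
    (hz : z ∈ apexCone m w c) : inner ℝ u (z - m) ≤ 0 := by
  set q := z - m with hq
  set r := -inner ℝ w q with hr
  set s := inner ℝ w u with hs
  set k := √(1 - c ^ 2) with hk
  have hk2 : k ^ 2 = 1 - c ^ 2 := Real.sq_sqrt (by nlinarith)
  have hk0 : 0 ≤ k := Real.sqrt_nonneg _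
  have hww : inner ℝ w w = (1 : ℝ) := by simp [hw]
  have hz' : c * ‖q‖ ≤ r := hz
  have hr0 : 0 ≤ r := le_trans (by positivity) hz'
  have hu' : k * ‖u - s • w‖ ≤ c * s := by
    have h : k / c * ‖u - s • w‖ ≤ s := hu
    have := mul_le_mul_of_nonneg_left h hc.le
    calc k * ‖u - s • w‖ = c * (k / c * ‖u - s • w‖) := by field_simp
      _ ≤ _ := this
  have hq2 : ‖q + r • w‖ ^ 2 = ‖q‖ ^ 2 - r ^ 2 := by
    rw [norm_add_sq_real, inner_smul_right, norm_smul, hw, real_inner_comm w q, Real.norm_eq_abs,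
      mul_one, sq_abs]
    have : inner ℝ w q = -r := by rw [hr]; ring
    rw [this]; ring
  have hq3 : c * ‖q + r • w‖ ≤ k * r := by
    apply le_of_sq_le_sq _ (by positivity)
    rw [mul_pow, mul_pow, hq2, hk2]
    nlinarith [pow_le_pow_left₀ (by positivity) hz' 2]
  have hdec : inner ℝ u q = -(s * r) + inner ℝ (u - s • w) (q + r • w) := by
    simp only [inner_sub_left, inner_add_right, inner_smul_left, inner_smul_right, hww,
      real_inner_comm w u]
    have : inner ℝ w q = -r := by rw [hr]; ring
    simp [this, ← hs]
  have hcs := real_inner_le_norm (u - s • w) (q + r • w)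
  have : c * inner ℝ u q ≤ 0 := by
    rw [hdec]
    calc c * (-(s * r) + inner ℝ (u - s • w) (q + r • w))
        ≤ c * (-(s * r) + ‖u - s • w‖ * ‖q + r • w‖) := by gcongr
      _ = -(c * s * r) + ‖u - s • w‖ * (c * ‖q + r • w‖) := by ring
      _ ≤ -(c * s * r) + ‖u - s • w‖ * (k * r) := by gcongr
      _ = (k * ‖u - s • w‖ - c * s) * r := by ring
      _ ≤ 0 := mul_nonpos_of_nonpos_of_nonneg (by linarith) hr0
  exact nonpos_of_mul_nonpos_right this hc

/-- The mean width drops by a multiple of `c ^ d * ‖x - b‖` when a compact set `L ∋ x` shrinks to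
`K ∋ b` and a cone with apex the midpoint of `x` and `b` contains `K`: for every direction in the
dual cone the support functions of `L` and `K` differ by at least the component of `x - m`. -/
theorem gaussianWidth_drop {d : ℕ} {K L : Set (EuclideanSpace ℝ (Fin d))} (hK : IsCompact K)
    (hL : IsCompact L) (hKL : K ⊆ L) {o x b w : EuclideanSpace ℝ (Fin d)} (hx : x ∈ L)
    (hb : b ∈ K) {c : ℝ} (hw : ‖w‖ = 1) (hc : 0 < c) (hc1 : c ≤ 1)
    (hcone : K ⊆ apexCone (midpoint ℝ x b) w c) :
    c ^ d * ((√(2 * Real.pi))⁻¹ * (‖x - b‖ / 2)) ≤ gaussianWidth o L - gaussianWidth o K := by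
  obtain _ | n := d
  · exact absurd hw (by simp [Subsingleton.elim w 0])
  set m := midpoint ℝ x b with hm
  have hxm : x - m = (1 / 2 : ℝ) • (x - b) := by
    rw [hm, midpoint_eq_smul_add]; norm_num [smul_sub]
    module
  have hbm : b - m = -((1 / 2 : ℝ) • (x - b)) := by
    rw [hm, midpoint_eq_smul_add]; norm_num [smul_sub]
    module
  set a := √(1 - c ^ 2) / c with ha
  have hsq : (√(1 + a ^ 2))⁻¹ = c := by
    have : 1 + a ^ 2 = (c⁻¹) ^ 2 := by
      rw [ha, div_pow, Real.sq_sqrt (by nlinarith)]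
      field_simp
      ring
    rw [this, Real.sqrt_sq (by positivity), inv_inv]
  have hmom := integral_axisCone_inner (E := EuclideanSpace ℝ (Fin (n + 1))) (n := n)
    (by simp) hw a (x - m)
  rw [hsq] at hmom
  have hax : c * (‖x - b‖ / 2) ≤ inner ℝ w (x - m) := by
    have h : c * ‖b - m‖ ≤ -inner ℝ w (b - m) := hcone hb
    rw [hbm, inner_neg_right, neg_neg, norm_neg, norm_smul] at h
    rw [hxm]
    norm_num at h ⊢
    linarith
  have hpt : ∀ u, (axisCone w a).indicator (fun u => inner ℝ (x - m) u) u ≤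
      supportFn o L u - supportFn o K u := by
    intro u
    by_cases hu : u ∈ axisCone w a
    · rw [Set.indicator_of_mem hu]
      have h1 := inner_le_supportFn (o := o) hL hx u
      have h2 : supportFn o K u ≤ inner ℝ u (m - o) := supportFn_le ⟨b, hb⟩ fun z hz => by
        have := inner_nonpos_of_mem_axisCone hw hc hc1 hu (hcone hz)
        have h : z - o = (z - m) + (m - o) := by abel
        rw [h, inner_add_right]
        linarith
      have h3 : x - o = (x - m) + (m - o) := by abel
      rw [h3, inner_add_right] at h1
      rw [real_inner_comm]
      linarith
    · rw [Set.indicator_of_notMem hu]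
      exact sub_nonneg.2 (supportFn_mono hL ⟨b, hb⟩ hKL u)
  have hiL := integrable_supportFn o hL ⟨x, hx⟩
  have hiK := integrable_supportFn o hK ⟨b, hb⟩
  rw [gaussianWidth, gaussianWidth, ← integral_sub hiL hiK]
  refine le_trans ?_ (integral_mono ((integrable_inner_stdGaussian (x - m)).indicator
    (isClosed_axisCone w a).measurableSet) (hiL.sub hiK) hpt)
  rw [hmom]
  calc c ^ (n + 1) * ((√(2 * Real.pi))⁻¹ * (‖x - b‖ / 2))
      = (√(2 * Real.pi))⁻¹ * c ^ n * (c * (‖x - b‖ / 2)) := by ring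
    _ ≤ _ := by gcongr

/-! ### Projections -/

variable {d : ℕ}

theorem IsProj.inner_nonpos {K : Set (EuclideanSpace ℝ (Fin d))} (hK : Convex ℝ K)
    {x y : EuclideanSpace ℝ (Fin d)} (h : IsProj K x y) :
    ∀ z ∈ K, inner ℝ (x - y) (z - y) ≤ 0 := by
  rw [← norm_eq_iInf_iff_real_inner_le_zero hK h.1]
  have : Nonempty K := ⟨⟨y, h.1⟩⟩
  exact le_antisymm (le_ciInf fun z => h.2 z z.2)
    (ciInf_le ⟨0, by rintro _ ⟨z, rfl⟩; exact norm_nonneg _⟩ (⟨y, h.1⟩ : K))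

theorem IsProj.norm_sub_le {K : Set (EuclideanSpace ℝ (Fin d))} (hK : Convex ℝ K)
    {x y u : EuclideanSpace ℝ (Fin d)} (h : IsProj K x y) (hu : u ∈ K) : ‖y - u‖ ≤ ‖x - u‖ := by
  have h1 := h.inner_nonpos hK u hu
  have h2 : x - u = (x - y) - (u - y) := by abel
  have h3 := norm_sub_sq_real (x - y) (u - y)
  rw [← h2, norm_sub_rev u y] at h3
  exact le_of_sq_le_sq (by nlinarith [sq_nonneg ‖x - y‖]) (norm_nonneg _)

theorem IsProj.norm_eq_infDist {K : Set (EuclideanSpace ℝ (Fin d))}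
    {x y : EuclideanSpace ℝ (Fin d)} (h : IsProj K x y) : ‖x - y‖ = Metric.infDist x K := by
  rw [← dist_eq_norm]
  refine le_antisymm ?_ (Metric.infDist_le_dist_of_mem h.1)
  rw [Metric.le_infDist ⟨y, h.1⟩]
  intro z hz
  rw [dist_eq_norm, dist_eq_norm]
  exact h.2 z hz

theorem exists_isProj {K : Set (EuclideanSpace ℝ (Fin d))} (hK : IsCompact K) (hne : K.Nonempty)
    (x : EuclideanSpace ℝ (Fin d)) : ∃ y, IsProj K x y := by
  obtain ⟨y, hy, h⟩ := hK.exists_infDist_eq_dist hne x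
  refine ⟨y, hy, fun z hz => ?_⟩
  rw [← dist_eq_norm, ← dist_eq_norm, ← h]
  exact Metric.infDist_le_dist_of_mem hz

/-! ### The narrowest cone -/

theorem convex_apexCone (m w : EuclideanSpace ℝ (Fin d)) {c : ℝ} (hc : 0 ≤ c) :
    Convex ℝ (apexCone m w c) := by
  intro z₁ h₁ z₂ h₂ s t hs ht hst
  change c * ‖_‖ ≤ - inner ℝ w _
  have h : s • z₁ + t • z₂ - m = s • (z₁ - m) + t • (z₂ - m) := by
    have : m = s • m + t • m := by rw [← add_smul, hst, one_smul]
    conv_lhs => rw [this]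
    module
  have h1 : c * ‖z₁ - m‖ ≤ -inner ℝ w (z₁ - m) := h₁
  have h2 : c * ‖z₂ - m‖ ≤ -inner ℝ w (z₂ - m) := h₂
  rw [h, inner_add_right, inner_smul_right, inner_smul_right]
  calc c * ‖s • (z₁ - m) + t • (z₂ - m)‖ ≤ c * (s * ‖z₁ - m‖ + t * ‖z₂ - m‖) := by
        gcongr
        refine (norm_add_le _ _).trans (le_of_eq ?_)
        rw [norm_smul, norm_smul, Real.norm_of_nonneg hs, Real.norm_of_nonneg ht]
    _ = s * (c * ‖z₁ - m‖) + t * (c * ‖z₂ - m‖) := by ring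
    _ ≤ s * (-inner ℝ w (z₁ - m)) + t * (-inner ℝ w (z₂ - m)) := by gcongr
    _ = _ := by ring

theorem coneCos_nonneg (m : EuclideanSpace ℝ (Fin d)) (K : Set (EuclideanSpace ℝ (Fin d))) :
    0 ≤ coneCos m K :=
  Real.sSup_nonneg fun _ h => h.1.le

/-- A cone with apex `m` that contains a point `z ≠ m` has cosine at most `1`. -/
theorem le_one_of_mem_apexCone {m w z : EuclideanSpace ℝ (Fin d)} {c : ℝ} (hw : ‖w‖ = 1)
    (hz : z ∈ apexCone m w c) (hzm : z ≠ m) : c ≤ 1 := by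
  have h : c * ‖z - m‖ ≤ -inner ℝ w (z - m) := hz
  have h1 := (abs_le.1 (abs_real_inner_le_norm w (z - m))).1
  rw [hw, one_mul] at h1
  have h2 : 0 < ‖z - m‖ := norm_pos_iff.2 (sub_ne_zero.2 hzm)
  by_contra! hc
  nlinarith

theorem subset_apexCone_of_convexHull {K : Set (EuclideanSpace ℝ (Fin d))}
    {m w : EuclideanSpace ℝ (Fin d)} {c : ℝ}
    (h : convexHull ℝ (insert m K) ⊆ apexCone m w c) : K ⊆ apexCone m w c :=
  ((Set.subset_insert m K).trans (subset_convexHull ℝ _)).trans h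

theorem midpoint_ne_right_of_ne {x b : EuclideanSpace ℝ (Fin d)} (h : x ≠ b) :
    b ≠ midpoint ℝ x b := fun hm => h ((right_eq_midpoint_iff (R := ℝ)).1 hm)

/-- A projection onto a convex set of diameter at most `D` leaves room for a cone: the set lies
beyond a hyperplane at distance `‖x - b‖ / 2` from the midpoint. -/
theorem norm_div_mem_cosines {K : Set (EuclideanSpace ℝ (Fin d))} (hK : Convex ℝ K)
    {x b : EuclideanSpace ℝ (Fin d)} (hb : IsProj K x b) (hxb : x ≠ b) {D : ℝ} (hD : 0 < D)
    (hKD : ∀ z ∈ K, ‖z - midpoint ℝ x b‖ ≤ D) :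
    ‖x - b‖ / (2 * D) ∈ {c : ℝ | 0 < c ∧ ∃ w : EuclideanSpace ℝ (Fin d), ‖w‖ = 1 ∧
      convexHull ℝ (insert (midpoint ℝ x b) K) ⊆ apexCone (midpoint ℝ x b) w c} := by
  set m := midpoint ℝ x b with hm
  have hpos : 0 < ‖x - b‖ := norm_pos_iff.2 (sub_ne_zero.2 hxb)
  refine ⟨by positivity, ‖x - b‖⁻¹ • (x - b), ?_, ?_⟩
  · rw [norm_smul, norm_inv, norm_norm, inv_mul_cancel₀ hpos.ne']
  · refine convexHull_min (Set.insert_subset ?_ ?_) (convex_apexCone _ _ (by positivity))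
    · change _ * ‖m - m‖ ≤ - inner ℝ _ (m - m)
      simp
    · intro z hz
      change ‖x - b‖ / (2 * D) * ‖z - m‖ ≤ - inner ℝ _ (z - m)
      have h1 := hb.inner_nonpos hK z hz
      have h2 : z - m = (z - b) - (1 / 2 : ℝ) • (x - b) := by
        rw [hm, midpoint_eq_smul_add]; norm_num [smul_sub]
        module
      have h3 : inner ℝ (‖x - b‖⁻¹ • (x - b)) (z - m) ≤ -(‖x - b‖ / 2) := by
        rw [real_inner_smul_left, h2, inner_sub_right, inner_smul_right,
          real_inner_self_eq_norm_sq]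
        have : ‖x - b‖⁻¹ * (inner ℝ (x - b) (z - b) - 1 / 2 * ‖x - b‖ ^ 2) =
          ‖x - b‖⁻¹ * inner ℝ (x - b) (z - b) - ‖x - b‖ / 2 := by field_simp
        rw [this]
        have := mul_nonpos_of_nonneg_of_nonpos (inv_nonneg.2 hpos.le) h1
        linarith
      have h4 : ‖x - b‖ / (2 * D) * ‖z - m‖ ≤ ‖x - b‖ / (2 * D) * D := by
        gcongr
        exact hKD z hz
      have h5 : ‖x - b‖ / (2 * D) * D = ‖x - b‖ / 2 := by field_simp
      linarith

/-! ### Constraint sets and actions -/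

namespace COCO

variable {P : COCO d}

theorem S_anti {s t : ℕ} (h : s ≤ t) : P.S t ⊆ P.S s := fun _ hz =>
  ⟨hz.1, fun r hr => hz.2 r (Finset.Icc_subset_Icc_right h hr)⟩

theorem S_subset (t : ℕ) : P.S t ⊆ P.X := fun _ hz => hz.1

theorem Standing.norm_sub_le (h : P.Standing) {x y : EuclideanSpace ℝ (Fin d)} (hx : x ∈ P.X)
    (hy : y ∈ P.X) : ‖x - y‖ ≤ P.D := by
  rw [← dist_eq_norm]
  exact Metric.dist_le_diam_of_mem h.bounded hx hy

theorem D_nonneg : 0 ≤ P.D := Metric.diam_nonneg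

theorem Standing.nonempty_S (h : P.Standing) {t : ℕ} (ht : t ≤ P.T) : (P.S t).Nonempty :=
  h.feasible.mono (S_anti ht)

theorem Standing.convex_S (h : P.Standing) {t : ℕ} (ht : t ≤ P.T) : Convex ℝ (P.S t) := by
  have : P.S t = P.X ∩ ⋂ s ∈ Finset.Icc 1 t, {z | z ∈ P.X ∧ P.g s z ≤ 0} := by
    ext z
    simp only [S, Set.mem_ofPred_eq, Set.mem_inter_iff, Set.mem_iInter]
    exact ⟨fun hz => ⟨hz.1, fun s hs => ⟨hz.1, hz.2 s hs⟩⟩, fun hz => ⟨hz.1, fun s hs =>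
      (hz.2 s hs).2⟩⟩
  rw [this]
  refine h.convex.inter (convex_iInter₂ fun s hs => ?_)
  exact (h.convex_g s (Finset.Icc_subset_Icc_right ht hs)).convex_le 0

theorem Standing.isCompact_S (h : P.Standing) {t : ℕ} (ht : t ≤ P.T) : IsCompact (P.S t) := by
  have hX : IsCompact P.X := Metric.isCompact_of_isClosed_isBounded h.closed h.bounded
  refine hX.of_isClosed_subset ?_ (S_subset t)
  have : P.S t = P.X ∩ ⋂ s ∈ Finset.Icc 1 t, (P.X ∩ P.g s ⁻¹' Set.Iic 0) := by
    ext z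
    simp only [S, Set.mem_ofPred_eq, Set.mem_inter_iff, Set.mem_iInter]
    exact ⟨fun hz => ⟨hz.1, fun s hs => ⟨hz.1, hz.2 s hs⟩⟩, fun hz => ⟨hz.1, fun s hs =>
      (hz.2 s hs).2⟩⟩
  rw [this]
  refine h.closed.inter (isClosed_biInter fun s hs => ?_)
  refine ContinuousOn.preimage_isClosed_of_isClosed ?_ h.closed isClosed_Iic
  refine (LipschitzOnWith.of_dist_le_mul (K := ⟨P.G, h.G_pos.le⟩) fun x hx y hy => ?_).continuousOn
  rw [Real.dist_eq, dist_eq_norm]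
  exact h.lipschitz_g s (Finset.Icc_subset_Icc_right ht hs) x hx y hy

theorem ccv_succ (x : ℕ → EuclideanSpace ℝ (Fin d)) (t : ℕ) :
    P.ccv x (t + 1) = P.ccv x t + max (P.g (t + 1) (x (t + 1))) 0 :=
  Finset.sum_Icc_succ_top (by omega) _

theorem ccv_mono (x : ℕ → EuclideanSpace ℝ (Fin d)) : Monotone (P.ccv x) :=
  monotone_nat_of_le_succ fun t => by
    rw [ccv_succ]
    exact le_add_of_nonneg_right (le_max_right _ _)

theorem FirstPhase.of_le {x : ℕ → EuclideanSpace ℝ (Fin d)} {s t : ℕ} (h : P.FirstPhase x t)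
    (hst : s ≤ t) : P.FirstPhase x s :=
  (ccv_mono x (Nat.sub_le_sub_right hst 1)).trans h

theorem firstPhase_one (x : ℕ → EuclideanSpace ℝ (Fin d)) : P.FirstPhase x 1 := by
  simp only [FirstPhase, ccv]
  simpa using mul_nonneg (Real.sqrt_nonneg _) (Real.log_natCast_nonneg _)

theorem IsSwitchRun.mem_S {x y p : ℕ → EuclideanSpace ℝ (Fin d)} (hr : P.IsSwitchRun x y p)
    {t : ℕ} (ht : t ∈ Finset.Icc 1 P.T) (h1 : P.FirstPhase x t) : x t ∈ P.S (t - 1) := by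
  rw [Finset.mem_Icc] at ht
  obtain rfl | ht1 := ht.1.eq_or_lt
  · exact ⟨hr.init, by simp⟩
  · obtain ⟨s, rfl⟩ : ∃ s, t = s + 1 := ⟨t - 1, by omega⟩
    exact (hr.next_first s (Finset.mem_Icc.2 (by omega)) (h1.of_le (by omega)) h1).1

theorem IsSwitchRun.mem_X {x y p : ℕ → EuclideanSpace ℝ (Fin d)} (hr : P.IsSwitchRun x y p)
    {t : ℕ} (ht : t ∈ Finset.Icc 1 P.T) : x t ∈ P.X := by
  by_cases h1 : P.FirstPhase x t
  · exact (hr.mem_S ht h1).1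
  rw [Finset.mem_Icc] at ht
  obtain rfl | ht1 := ht.1.eq_or_lt
  · exact hr.init
  · obtain ⟨s, rfl⟩ : ∃ s, t = s + 1 := ⟨t - 1, by omega⟩
    have hs : s ∈ Finset.Icc 1 P.T := Finset.mem_Icc.2 (by omega)
    by_cases h2 : P.FirstPhase x s
    · exact hr.switch s hs h2 h1
    · exact (hr.step_second s hs h2).1

theorem Standing.violation_le (h : P.Standing) {t : ℕ} (ht : t ∈ Finset.Icc 1 P.T)
    {x z : EuclideanSpace ℝ (Fin d)} (hx : x ∈ P.X) (hz : z ∈ P.S t) :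
    max (P.g t x) 0 ≤ P.G * ‖x - z‖ := by
  have h1 := (abs_le.1 (h.lipschitz_g t ht x hx z hz.1)).2
  have h2 := hz.2 t (Finset.mem_Icc.2 ⟨(Finset.mem_Icc.1 ht).1, le_rfl⟩)
  have := mul_nonneg h.G_pos.le (norm_nonneg (x - z))
  exact max_le (by linarith) this

/-! ### The violation of the first phase -/

theorem cStar_nonneg (x : ℕ → EuclideanSpace ℝ (Fin d)) : 0 ≤ P.cStar x :=
  Real.sInf_nonneg (by
    rintro c (rfl | ⟨t, -, -, -, b, -, rfl⟩)
    · exact zero_le_one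
    · exact coneCos_nonneg _ _)

theorem cStar_le_coneCos (x : ℕ → EuclideanSpace ℝ (Fin d)) {t : ℕ} (ht : t ∈ Finset.Icc 1 P.T)
    (h1 : P.FirstPhase x t) (hx : x t ∉ P.S t) {b : EuclideanSpace ℝ (Fin d)}
    (hb : IsProj (P.S t) (x t) b) : P.cStar x ≤ coneCos (midpoint ℝ (x t) b) (P.S t) := by
  refine csInf_le ⟨0, ?_⟩ (Or.inr ⟨t, ht, h1, hx, b, hb, rfl⟩)
  rintro c (rfl | ⟨t, -, -, -, b, -, rfl⟩)
  · exact zero_le_one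
  · exact coneCos_nonneg _ _

theorem Standing.infDist_div_mem_cosines (h : P.Standing) {t : ℕ} (ht : t ∈ Finset.Icc 1 P.T)
    {x b : EuclideanSpace ℝ (Fin d)} (hx : x ∈ P.X) (hxS : x ∉ P.S t) (hb : IsProj (P.S t) x b) :
    Metric.infDist x (P.S t) / (2 * P.D) ∈ {c : ℝ | 0 < c ∧ ∃ w : EuclideanSpace ℝ (Fin d),
      ‖w‖ = 1 ∧ convexHull ℝ (insert (midpoint ℝ x b) (P.S t)) ⊆
        apexCone (midpoint ℝ x b) w c} := by
  have hxb : x ≠ b := by rintro rfl; exact hxS hb.1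
  have hD : 0 < P.D := (norm_pos_iff.2 (sub_ne_zero.2 hxb)).trans_le (h.norm_sub_le hx hb.1.1)
  rw [← hb.norm_eq_infDist]
  refine norm_div_mem_cosines (h.convex_S (Finset.mem_Icc.1 ht).2) hb hxb hD fun z hz => ?_
  exact h.norm_sub_le hz.1 (h.convex.segment_subset hx hb.1.1 (midpoint_mem_segment _ _))

theorem cosines_le_one {t : ℕ} {x b : EuclideanSpace ℝ (Fin d)} (hxS : x ∉ P.S t)
    (hb : b ∈ P.S t) : ∀ c ∈ {c : ℝ | 0 < c ∧ ∃ w : EuclideanSpace ℝ (Fin d),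
      ‖w‖ = 1 ∧ convexHull ℝ (insert (midpoint ℝ x b) (P.S t)) ⊆
        apexCone (midpoint ℝ x b) w c}, c ≤ 1 := by
  rintro c ⟨-, w, hw, hc⟩
  have hxb : x ≠ b := by rintro rfl; exact hxS hb
  exact le_one_of_mem_apexCone hw (subset_apexCone_of_convexHull hc hb)
    (midpoint_ne_right_of_ne hxb)

/-- Each of the finitely many rounds leaves room for a cone with a cosine bounded below in terms of
the distance from the action to the constraint set. -/
theorem IsSwitchRun.cStar_pos (h : P.Standing) {x y p : ℕ → EuclideanSpace ℝ (Fin d)}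
    (hr : P.IsSwitchRun x y p) : 0 < P.cStar x := by
  have hpos : ∀ t ∈ Finset.Icc 1 P.T, x t ∉ P.S t →
      0 < Metric.infDist (x t) (P.S t) / (2 * P.D) := by
    intro t ht hxS
    have htT := (Finset.mem_Icc.1 ht).2
    obtain ⟨b, hb⟩ := exists_isProj (h.isCompact_S htT) (h.nonempty_S htT) (x t)
    exact (h.infDist_div_mem_cosines ht (hr.mem_X ht) hxS hb).1
  have hev : ∀ᶠ ε in nhdsWithin (0 : ℝ) (Set.Ioi 0), ∀ t ∈ Finset.Icc 1 P.T, x t ∉ P.S t →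
      ε ≤ Metric.infDist (x t) (P.S t) / (2 * P.D) := by
    rw [Filter.eventually_all_finset]
    intro t ht
    by_cases hxS : x t ∈ P.S t
    · exact Filter.Eventually.of_forall fun _ h => absurd hxS h
    · filter_upwards [Ioc_mem_nhdsGT (hpos t ht hxS)] with ε hε _ using hε.2
  obtain ⟨ε, hε, hε1⟩ := (hev.and (Ioc_mem_nhdsGT (zero_lt_one' ℝ))).exists
  refine hε1.1.trans_le (le_csInf ⟨1, Or.inl rfl⟩ ?_)
  rintro c (rfl | ⟨t, ht, h1, hxS, b, hb, rfl⟩)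
  · exact hε1.2
  · exact (hε t ht hxS).trans (le_csSup ⟨1, cosines_le_one hxS hb.1⟩
      (h.infDist_div_mem_cosines ht (hr.mem_X ht) hxS hb))

/-- One round of the first phase: the distance from the action to the new constraint set is paid
for by a drop of the mean width of the constraint set. -/
theorem IsSwitchRun.cStar_pow_mul_infDist_le (h : P.Standing)
    {x y p : ℕ → EuclideanSpace ℝ (Fin d)} (hr : P.IsSwitchRun x y p)
    (o : EuclideanSpace ℝ (Fin d)) {t : ℕ} (ht : t ∈ Finset.Icc 1 P.T) (h1 : P.FirstPhase x t) :
    P.cStar x ^ d * ((√(2 * Real.pi))⁻¹ * (Metric.infDist (x t) (P.S t) / 2)) ≤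
      gaussianWidth o (P.S (t - 1)) - gaussianWidth o (P.S t) := by
  have htT := (Finset.mem_Icc.1 ht).2
  have htT' : t - 1 ≤ P.T := (Nat.sub_le _ _).trans htT
  have hK := h.isCompact_S htT
  have hL := h.isCompact_S htT'
  have hne := h.nonempty_S htT
  have hKL : P.S t ⊆ P.S (t - 1) := S_anti (Nat.sub_le _ _)
  by_cases hxS : x t ∈ P.S t
  · rw [Metric.infDist_zero_of_mem hxS]
    simpa using gaussianWidth_mono hK hL hne hKL
  obtain ⟨b, hb⟩ := exists_isProj hK hne (x t)
  rw [← hb.norm_eq_infDist]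
  set A := {c : ℝ | 0 < c ∧ ∃ w : EuclideanSpace ℝ (Fin d), ‖w‖ = 1 ∧
    convexHull ℝ (insert (midpoint ℝ (x t) b) (P.S t)) ⊆ apexCone (midpoint ℝ (x t) b) w c}
  have hle := cosines_le_one hxS hb.1
  have hA : A.Nonempty := ⟨_, h.infDist_div_mem_cosines ht (hr.mem_X ht) hxS hb⟩
  -- the supremum need not be attained, but the bound is a closed condition on `c`
  have hcl : coneCos (midpoint ℝ (x t) b) (P.S t) ∈ closure A :=
    (isLUB_csSup hA ⟨1, hle⟩).mem_closure hA
  have hsub : closure A ⊆ {c : ℝ | c ^ d * ((√(2 * Real.pi))⁻¹ * (‖x t - b‖ / 2)) ≤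
      gaussianWidth o (P.S (t - 1)) - gaussianWidth o (P.S t)} := by
    refine closure_minimal ?_ (isClosed_le (by fun_prop) (by fun_prop))
    rintro c ⟨hc0, w, hw, hcone⟩
    exact gaussianWidth_drop hK hL hKL (hr.mem_S ht h1) hb.1 hw hc0 (hle c ⟨hc0, w, hw, hcone⟩)
      (subset_apexCone_of_convexHull hcone)
  refine le_trans ?_ (hsub hcl)
  have := cStar_le_coneCos x ht h1 hxS hb
  have := cStar_nonneg (P := P) x
  gcongr

/-- The violation of the first phase, by telescoping the mean widths of the constraint sets. -/
theorem IsSwitchRun.ccv_le_of_firstPhase (h : P.Standing)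
    {x y p : ℕ → EuclideanSpace ℝ (Fin d)} (hr : P.IsSwitchRun x y p) {τ : ℕ} (hτ : τ ≤ P.T)
    (h1 : P.FirstPhase x τ) :
    P.ccv x τ ≤ 2 * √(2 * Real.pi) * (P.G * (√(d : ℝ) * (1 / P.cStar x) ^ d * P.D)) := by
  obtain ⟨o, ho⟩ := h.feasible
  have hc := hr.cStar_pos h
  set k := P.cStar x ^ d * ((√(2 * Real.pi))⁻¹ * (1 / 2)) with hk
  have hk0 : 0 < k := by positivity
  have key : ∀ n ≤ τ, k * P.ccv x n ≤
      P.G * (gaussianWidth o (P.S 0) - gaussianWidth o (P.S n)) := by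
    intro n
    induction n with
    | zero => simp [ccv]
    | succ n ih =>
      intro hn
      have ht : n + 1 ∈ Finset.Icc 1 P.T := Finset.mem_Icc.2 (by omega)
      have hstep := hr.cStar_pow_mul_infDist_le h o ht (h1.of_le hn)
      rw [Nat.add_sub_cancel] at hstep
      obtain ⟨b, hb⟩ := exists_isProj (h.isCompact_S (hn.trans hτ)) (h.nonempty_S (hn.trans hτ))
        (x (n + 1))
      have hv := h.violation_le ht (hr.mem_X ht) hb.1
      rw [hb.norm_eq_infDist] at hv
      rw [ccv_succ]
      calc k * (P.ccv x n + max (P.g (n + 1) (x (n + 1))) 0)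
          ≤ k * (P.ccv x n + P.G * Metric.infDist (x (n + 1)) (P.S (n + 1))) := by gcongr
        _ = k * P.ccv x n + P.G * (P.cStar x ^ d * ((√(2 * Real.pi))⁻¹ *
              (Metric.infDist (x (n + 1)) (P.S (n + 1)) / 2))) := by rw [hk]; ring
        _ ≤ P.G * (gaussianWidth o (P.S 0) - gaussianWidth o (P.S n)) + P.G *
              (gaussianWidth o (P.S n) - gaussianWidth o (P.S (n + 1))) :=
            add_le_add (ih (by omega)) (mul_le_mul_of_nonneg_left hstep h.G_pos.le)
        _ = _ := by ring
  have h0 := key τ le_rfl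
  have hw0 : gaussianWidth o (P.S 0) ≤ P.D * √(d : ℝ) := by
    simpa using gaussianWidth_le (h.isCompact_S (Nat.zero_le _)) (h.nonempty_S (Nat.zero_le _))
      D_nonneg fun z hz => h.norm_sub_le hz.1 ho.1
  have hw1 : 0 ≤ gaussianWidth o (P.S τ) := gaussianWidth_nonneg (h.isCompact_S hτ) (S_anti hτ ho)
  have h2 : k * P.ccv x τ ≤ P.G * (P.D * √(d : ℝ)) :=
    h0.trans (mul_le_mul_of_nonneg_left (by linarith) h.G_pos.le)
  calc P.ccv x τ = k⁻¹ * (k * P.ccv x τ) := by field_simp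
    _ ≤ k⁻¹ * (P.G * (P.D * √(d : ℝ))) := by gcongr
    _ = _ := by
      rw [hk]
      simp only [mul_inv, one_div, inv_inv, inv_pow]
      ring

end COCO

/-! ### Gradient steps -/

/-- One step of projected gradient descent, seen from a point `u` of the set projected onto. -/
theorem IsProj.two_mul_inner_le {K : Set (EuclideanSpace ℝ (Fin d))} (hK : Convex ℝ K)
    {x y p u : EuclideanSpace ℝ (Fin d)} {η : ℝ} (h : IsProj K (x - η • p) y) (hu : u ∈ K) :
    2 * η * inner ℝ p (x - u) ≤ ‖x - u‖ ^ 2 - ‖y - u‖ ^ 2 + η ^ 2 * ‖p‖ ^ 2 := by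
  have h1 := pow_le_pow_left₀ (norm_nonneg _) (h.norm_sub_le hK hu) 2
  have h2 : x - η • p - u = (x - u) - η • p := by abel
  rw [h2, norm_sub_sq_real (x - u), inner_smul_right, norm_smul, mul_pow, Real.norm_eq_abs, sq_abs,
    real_inner_comm] at h1
  linarith

theorem IsSubgrad.sub_le {X : Set (EuclideanSpace ℝ (Fin d))}
    {φ : EuclideanSpace ℝ (Fin d) → ℝ} {L : ℝ} {x p u : EuclideanSpace ℝ (Fin d)}
    (h : IsSubgrad X φ L x p) (hu : u ∈ X) : φ x - φ u ≤ inner ℝ p (x - u) := by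
  have h1 := h.2 u hu
  rw [← neg_sub x u, inner_neg_right] at h1
  linarith

/-! ### The regret of the first phase -/

namespace COCO

variable {P : COCO d}

/-- The regret over the first phase. The coefficient `√n` in the induction hypothesis absorbs the
growth of the inverse step size, because `‖x - u‖ ≤ D`. -/
theorem IsSwitchRun.regret_first (h : P.Standing) (hD : 0 < P.D)
    {x y p : ℕ → EuclideanSpace ℝ (Fin d)} (hr : P.IsSwitchRun x y p)
    {u : EuclideanSpace ℝ (Fin d)} (hu : u ∈ P.S P.T) {τ : ℕ} (hτ : τ ∈ Finset.Icc 1 P.T)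
    (h1 : P.FirstPhase x τ) :
    ∑ t ∈ Finset.Icc 1 τ, (P.f t (x t) - P.f t u) ≤ 3 / 2 * (P.G * P.D * √(τ : ℝ)) := by
  have hG := h.G_pos
  have hround : ∀ n, n + 1 ∈ Finset.Icc 1 P.T → P.FirstPhase x (n + 1) →
      ∑ t ∈ Finset.Icc 1 n, (P.f t (x t) - P.f t u) ≤
        P.G * √(n : ℝ) / (2 * P.D) * (P.D ^ 2 - ‖x (n + 1) - u‖ ^ 2) + P.G * P.D * √(n : ℝ) →
      ∑ t ∈ Finset.Icc 1 (n + 1), (P.f t (x t) - P.f t u) ≤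
        P.G * √((n + 1 : ℕ) : ℝ) / (2 * P.D) * (P.D ^ 2 - ‖y (n + 1) - u‖ ^ 2) +
          P.G * P.D * √((n + 1 : ℕ) : ℝ) := by
    intro n hn hfp ih
    have hnT := (Finset.mem_Icc.1 hn).2
    set t := n + 1 with ht
    have ht0 : (0 : ℝ) < t := by rw [ht]; positivity
    set r := √(t : ℝ) with hrdef
    have hr0 : 0 < r := Real.sqrt_pos.2 ht0
    have hq0 : 0 ≤ √(n : ℝ) := Real.sqrt_nonneg _
    have hqr : √(n : ℝ) ≤ r := Real.sqrt_le_sqrt (by rw [ht]; push_cast; linarith)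
    have hr2 : r ^ 2 = √(n : ℝ) ^ 2 + 1 := by
      rw [hrdef, Real.sq_sqrt ht0.le, Real.sq_sqrt (by positivity), ht]; push_cast; ring
    have hsub := (hr.grad_first t hn hfp).sub_le hu.1
    have hnorm := (hr.grad_first t hn hfp).1
    have hstep := (hr.step_first t hn hfp).two_mul_inner_le
      (h.convex_S ((Nat.sub_le _ _).trans hnT)) (S_anti ((Nat.sub_le _ _).trans hnT) hu)
    have hx := pow_le_pow_left₀ (norm_nonneg _) (h.norm_sub_le (hr.mem_X hn) hu.1) 2
    have hstep' : P.f t (x t) - P.f t u ≤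
        P.G * r / (2 * P.D) * (‖x t - u‖ ^ 2 - ‖y t - u‖ ^ 2) + P.G * P.D * (1 / (2 * r)) := by
      have hp2 := pow_le_pow_left₀ (norm_nonneg _) hnorm 2
      calc P.f t (x t) - P.f t u ≤ inner ℝ (p t) (x t - u) := hsub
        _ = P.G * r / (2 * P.D) * (2 * (P.D / (P.G * r)) * inner ℝ (p t) (x t - u)) := by
            field_simp
        _ ≤ P.G * r / (2 * P.D) * (‖x t - u‖ ^ 2 - ‖y t - u‖ ^ 2 +
              (P.D / (P.G * r)) ^ 2 * P.G ^ 2) := by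
            gcongr
            refine hstep.trans ?_
            gcongr
        _ = _ := by field_simp
    have hinv : 1 / (2 * r) ≤ r - √(n : ℝ) := by
      rw [div_le_iff₀ (by positivity)]
      nlinarith
    rw [Finset.sum_Icc_succ_top (by omega)]
    have hA : P.G * √(n : ℝ) / (2 * P.D) * (P.D ^ 2 - ‖x t - u‖ ^ 2) ≤
        P.G * r / (2 * P.D) * (P.D ^ 2 - ‖x t - u‖ ^ 2) := by
      have : 0 ≤ P.D ^ 2 - ‖x t - u‖ ^ 2 := by linarith
      gcongr
    have hB : P.G * P.D * (1 / (2 * r)) ≤ P.G * P.D * (r - √(n : ℝ)) := by gcongr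
    calc _ ≤ (P.G * √(n : ℝ) / (2 * P.D) * (P.D ^ 2 - ‖x t - u‖ ^ 2) + P.G * P.D * √(n : ℝ)) +
          (P.G * r / (2 * P.D) * (‖x t - u‖ ^ 2 - ‖y t - u‖ ^ 2) + P.G * P.D * (1 / (2 * r))) :=
          add_le_add ih hstep'
      _ ≤ (P.G * r / (2 * P.D) * (P.D ^ 2 - ‖x t - u‖ ^ 2) + P.G * P.D * √(n : ℝ)) +
          (P.G * r / (2 * P.D) * (‖x t - u‖ ^ 2 - ‖y t - u‖ ^ 2) +
            P.G * P.D * (r - √(n : ℝ))) := by gcongr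
      _ = _ := by ring
  have hind : ∀ n, n + 1 ∈ Finset.Icc 1 P.T → P.FirstPhase x (n + 1) →
      ∑ t ∈ Finset.Icc 1 n, (P.f t (x t) - P.f t u) ≤
        P.G * √(n : ℝ) / (2 * P.D) * (P.D ^ 2 - ‖x (n + 1) - u‖ ^ 2) + P.G * P.D * √(n : ℝ) := by
    intro n
    induction n with
    | zero => simp
    | succ n ih =>
      intro hn hfp
      have hn' : n + 1 ∈ Finset.Icc 1 P.T := by rw [Finset.mem_Icc] at hn ⊢; omega
      have hnT := (Finset.mem_Icc.1 hn').2
      have hfp' := hfp.of_le (Nat.le_succ _)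
      refine (hround n hn' hfp' (ih hn' hfp')).trans ?_
      have hx := (hr.next_first _ hn' hfp' hfp).norm_sub_le (h.convex_S hnT) (S_anti hnT hu)
      gcongr
  obtain ⟨n, rfl⟩ : ∃ n, τ = n + 1 := ⟨τ - 1, by have := (Finset.mem_Icc.1 hτ).1; omega⟩
  refine (hround n hτ h1 (hind n hτ h1)).trans ?_
  set r := √((n + 1 : ℕ) : ℝ)
  calc P.G * r / (2 * P.D) * (P.D ^ 2 - ‖y (n + 1) - u‖ ^ 2) + P.G * P.D * r
      ≤ P.G * r / (2 * P.D) * P.D ^ 2 + P.G * P.D * r := by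
        gcongr
        linarith [sq_nonneg ‖y (n + 1) - u‖]
    _ = _ := by field_simp; ring

/-! ### The second phase -/

theorem deriv_Φ (q : ℝ) :
    deriv P.Φ q = 1 / (2 * √(P.T : ℝ)) * Real.exp (1 / (2 * √(P.T : ℝ)) * q) := by
  have h : HasDerivAt P.Φ (1 / (2 * √(P.T : ℝ)) * Real.exp (1 / (2 * √(P.T : ℝ)) * q)) q := by
    have := (((hasDerivAt_id q).const_mul (1 / (2 * √(P.T : ℝ)))).exp).sub_const 1
    exact this.congr_deriv (by simp [mul_comm])
  exact h.deriv

theorem deriv_Φ_nonneg (q : ℝ) : 0 ≤ deriv P.Φ q := by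
  rw [deriv_Φ]
  positivity

theorem deriv_Φ_mono : Monotone (deriv P.Φ) := by
  intro q r hqr
  rw [deriv_Φ, deriv_Φ]
  gcongr

/-- Convexity of the potential. -/
theorem Φ_sub_le (q r : ℝ) : P.Φ q - P.Φ r ≤ deriv P.Φ q * (q - r) := by
  rw [deriv_Φ, Φ, Φ]
  set l := 1 / (2 * √(P.T : ℝ))
  have h := Real.add_one_le_exp (l * r - l * q)
  have h2 := Real.exp_pos (l * q)
  have h3 : Real.exp (l * r) = Real.exp (l * q) * Real.exp (l * r - l * q) := by
    rw [← Real.exp_add]; congr 1; ring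
  rw [h3]
  nlinarith [mul_le_mul_of_nonneg_left h h2.le]

theorem Standing.β_nonneg (h : P.Standing) : 0 ≤ P.β := by
  have := h.G_pos
  have := D_nonneg (P := P)
  unfold β
  positivity

open Classical in
theorem sum_filter_Icc_succ (x : ℕ → EuclideanSpace ℝ (Fin d)) (F : ℕ → ℝ) (n : ℕ) :
    ∑ s ∈ Finset.Icc 1 (n + 1) with ¬ P.FirstPhase x s, F s =
      ∑ s ∈ Finset.Icc 1 n with ¬ P.FirstPhase x s, F s +
        if P.FirstPhase x (n + 1) then 0 else F (n + 1) := by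
  rw [Finset.sum_filter, Finset.sum_filter, Finset.sum_Icc_succ_top (by omega), ite_not]

theorem scaledCCV_succ (x : ℕ → EuclideanSpace ℝ (Fin d)) {n : ℕ}
    (h2 : ¬ P.FirstPhase x (n + 1)) : P.scaledCCV x (n + 1) =
      P.scaledCCV x n + P.β * max 0 (P.g (n + 1) (x (n + 1))) := by
  rw [scaledCCV, scaledCCV, sum_filter_Icc_succ, if_neg h2]

theorem Standing.scaledCCV_mono (h : P.Standing) (x : ℕ → EuclideanSpace ℝ (Fin d)) :
    Monotone (P.scaledCCV x) := by
  refine monotone_nat_of_le_succ fun n => ?_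
  rw [scaledCCV, scaledCCV, sum_filter_Icc_succ]
  have := mul_nonneg h.β_nonneg (le_max_left 0 (P.g (n + 1) (x (n + 1))))
  split_ifs <;> linarith

open Classical in
/-- The regret of the adaptive gradient steps on the surrogate costs. -/
theorem IsSwitchRun.surrogate_regret (h : P.Standing) (hD : 0 < P.D)
    {x y p : ℕ → EuclideanSpace ℝ (Fin d)} (hr : P.IsSwitchRun x y p)
    {u : EuclideanSpace ℝ (Fin d)} (hu : u ∈ P.X) :
    ∑ s ∈ Finset.Icc 1 P.T with ¬ P.FirstPhase x s, (P.surrogate x s (x s) - P.surrogate x s u) ≤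
      √2 * P.D * √(∑ s ∈ Finset.Icc 1 P.T with ¬ P.FirstPhase x s, ‖p s‖ ^ 2) := by
  set V : ℕ → ℝ := fun n => ∑ s ∈ Finset.Icc 1 n with ¬ P.FirstPhase x s, ‖p s‖ ^ 2 with hV
  have hV0 : ∀ n, 0 ≤ V n := fun n => Finset.sum_nonneg fun s _ => sq_nonneg _
  have h2 : √(2 : ℝ) ^ 2 = 2 := Real.sq_sqrt (by norm_num)
  have h20 : 0 < √(2 : ℝ) := by positivity
  have hind : ∀ n ≤ P.T,
      ∑ s ∈ Finset.Icc 1 n with ¬ P.FirstPhase x s, (P.surrogate x s (x s) - P.surrogate x s u) ≤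
        √(V n) / (√2 * P.D) * (P.D ^ 2 - ‖x (n + 1) - u‖ ^ 2) + √2 * P.D / 2 * √(V n) := by
    intro n
    induction n with
    | zero => simp [hV]
    | succ n ih =>
      intro hn
      by_cases hfp : P.FirstPhase x (n + 1)
      · have hempty : (Finset.Icc 1 (n + 1)).filter (fun s => ¬ P.FirstPhase x s) = ∅ :=
          Finset.filter_eq_empty_iff.2 fun s hs =>
            not_not.2 (hfp.of_le (Finset.mem_Icc.1 hs).2)
        simp [hV, hempty]
      · have ht : n + 1 ∈ Finset.Icc 1 P.T := Finset.mem_Icc.2 (by omega)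
        have hVs : V (n + 1) = V n + ‖p (n + 1)‖ ^ 2 := by
          simp only [hV]
          rw [sum_filter_Icc_succ, if_neg hfp]
        rw [sum_filter_Icc_succ, if_neg hfp]
        have hsub := (hr.grad_second _ ht hfp).sub_le hu
        have hstep := (hr.step_second _ ht hfp).two_mul_inner_le h.convex hu
        have hη : P.adaptiveStep x p (n + 1) = √2 * P.D / (2 * √(V (n + 1))) := rfl
        rw [hη] at hstep
        have hx := pow_le_pow_left₀ (norm_nonneg _) (h.norm_sub_le (hr.mem_X ht) hu) 2
        have hx' : 0 ≤ P.D ^ 2 - ‖x (n + 1) - u‖ ^ 2 := by linarith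
        have ih := ih (by omega)
        have hmono : √(V n) ≤ √(V (n + 1)) := Real.sqrt_le_sqrt (by rw [hVs]; nlinarith)
        have hVn : √(V n) ^ 2 = V n := Real.sq_sqrt (hV0 n)
        have hVn1 : √(V (n + 1)) ^ 2 = V (n + 1) := Real.sq_sqrt (hV0 (n + 1))
        have hb0 : 0 ≤ √(V n) := Real.sqrt_nonneg _
        set a := √(V (n + 1)) with ha
        set b := √(V n) with hb
        set q := inner ℝ (p (n + 1)) (x (n + 1) - u)
        obtain ha0 | ha0 := (Real.sqrt_nonneg (V (n + 1))).eq_or_lt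
        · -- the denominator of the step vanishes, but then so does the gradient
          have ha0 : a = 0 := ha0.symm
          have hb0 : b = 0 := le_antisymm (ha0 ▸ hmono) hb0
          have hp : p (n + 1) = 0 := by
            have : ‖p (n + 1)‖ ^ 2 = 0 := by
              rw [ha0] at hVn1; rw [hb0] at hVn; linarith
            simpa using this
          have hq : q = 0 := by simp [q, hp]
          rw [hb0] at ih
          rw [ha0]
          simp only [zero_div, zero_mul, mul_zero, add_zero] at ih ⊢
          linarith
        · have ha0 : 0 < a := ha0
          have hinner : q ≤ a / (√2 * P.D) * (‖x (n + 1) - u‖ ^ 2 - ‖x (n + 1 + 1) - u‖ ^ 2) +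
              √2 * P.D / 2 * (a - b) := by
            have hpa : ‖p (n + 1)‖ ^ 2 ≤ 2 * a * (a - b) := by nlinarith
            calc q = a / (√2 * P.D) * (2 * (√2 * P.D / (2 * a)) * q) := by field_simp
              _ ≤ a / (√2 * P.D) * (‖x (n + 1) - u‖ ^ 2 - ‖x (n + 1 + 1) - u‖ ^ 2 +
                    (√2 * P.D / (2 * a)) ^ 2 * ‖p (n + 1)‖ ^ 2) := by gcongr
              _ ≤ a / (√2 * P.D) * (‖x (n + 1) - u‖ ^ 2 - ‖x (n + 1 + 1) - u‖ ^ 2 +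
                    (√2 * P.D / (2 * a)) ^ 2 * (2 * a * (a - b))) := by gcongr
              _ = _ := by
                field_simp
          have hA : b / (√2 * P.D) * (P.D ^ 2 - ‖x (n + 1) - u‖ ^ 2) ≤
              a / (√2 * P.D) * (P.D ^ 2 - ‖x (n + 1) - u‖ ^ 2) := by gcongr
          linarith
  refine (hind P.T le_rfl).trans ?_
  set a := √(V P.T)
  have ha : 0 ≤ a := Real.sqrt_nonneg _
  calc a / (√2 * P.D) * (P.D ^ 2 - ‖x (P.T + 1) - u‖ ^ 2) + √2 * P.D / 2 * a
      ≤ a / (√2 * P.D) * P.D ^ 2 + √2 * P.D / 2 * a := by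
        gcongr
        linarith [sq_nonneg ‖x (P.T + 1) - u‖]
    _ = √2 * P.D * a := by
      field_simp
      rw [h2]
      ring

open Classical in
/-- Against a feasible point, the surrogate regret dominates the scaled regret and the potential
of the scaled violation together. -/
theorem potential_add_regret_le (x : ℕ → EuclideanSpace ℝ (Fin d))
    {u : EuclideanSpace ℝ (Fin d)} (hu : u ∈ P.S P.T) :
    P.Φ (P.scaledCCV x P.T) +
        P.β * ∑ s ∈ Finset.Icc 1 P.T with ¬ P.FirstPhase x s, (P.f s (x s) - P.f s u) ≤
      ∑ s ∈ Finset.Icc 1 P.T with ¬ P.FirstPhase x s,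
        (P.surrogate x s (x s) - P.surrogate x s u) := by
  suffices hind : ∀ n ≤ P.T, P.Φ (P.scaledCCV x n) +
        P.β * ∑ s ∈ Finset.Icc 1 n with ¬ P.FirstPhase x s, (P.f s (x s) - P.f s u) ≤
      ∑ s ∈ Finset.Icc 1 n with ¬ P.FirstPhase x s,
        (P.surrogate x s (x s) - P.surrogate x s u) from hind P.T le_rfl
  intro n
  induction n with
  | zero => simp [scaledCCV, Φ]
  | succ n ih =>
    intro hn
    have ih := ih (by omega)
    by_cases hfp : P.FirstPhase x (n + 1)
    · have hQ : P.scaledCCV x (n + 1) = P.scaledCCV x n := by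
        rw [scaledCCV, scaledCCV, sum_filter_Icc_succ, if_pos hfp, add_zero]
      rw [hQ, sum_filter_Icc_succ, sum_filter_Icc_succ, if_pos hfp, if_pos hfp, add_zero, add_zero]
      exact ih
    · rw [sum_filter_Icc_succ, sum_filter_Icc_succ, if_neg hfp, if_neg hfp, mul_add]
      have hΦ := Φ_sub_le (P := P) (P.scaledCCV x (n + 1)) (P.scaledCCV x n)
      have hd : P.scaledCCV x (n + 1) - P.scaledCCV x n =
          P.β * max 0 (P.g (n + 1) (x (n + 1))) := by rw [scaledCCV_succ x hfp]; ring
      rw [hd] at hΦ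
      have hgu : max 0 (P.g (n + 1) u) = 0 :=
        max_eq_left (hu.2 (n + 1) (Finset.mem_Icc.2 (by omega)))
      simp only [surrogate] at ih ⊢
      rw [hgu]
      linarith

open Classical in
theorem IsSwitchRun.sqrt_sum_norm_sq_le (h : P.Standing)
    {x y p : ℕ → EuclideanSpace ℝ (Fin d)} (hr : P.IsSwitchRun x y p) :
    √(∑ s ∈ Finset.Icc 1 P.T with ¬ P.FirstPhase x s, ‖p s‖ ^ 2) ≤
      √(P.T : ℝ) * P.surrogateLip x P.T := by
  have hG := h.G_pos
  have hβ := h.β_nonneg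
  have hL : 0 ≤ P.surrogateLip x P.T := by
    have := deriv_Φ_nonneg (P := P) (P.scaledCCV x P.T)
    unfold surrogateLip
    positivity
  have hle : ∑ s ∈ Finset.Icc 1 P.T with ¬ P.FirstPhase x s, ‖p s‖ ^ 2 ≤
      P.T * P.surrogateLip x P.T ^ 2 := by
    calc ∑ s ∈ Finset.Icc 1 P.T with ¬ P.FirstPhase x s, ‖p s‖ ^ 2
        ≤ ∑ s ∈ Finset.Icc 1 P.T with ¬ P.FirstPhase x s, P.surrogateLip x P.T ^ 2 := by
          refine Finset.sum_le_sum fun s hs => ?_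
          obtain ⟨hs, hfp⟩ := Finset.mem_filter.1 hs
          refine pow_le_pow_left₀ (norm_nonneg _) ((hr.grad_second s hs hfp).1.trans ?_) 2
          have := deriv_Φ_mono (P := P) (h.scaledCCV_mono x (Finset.mem_Icc.1 hs).2)
          unfold surrogateLip
          gcongr
      _ ≤ ∑ s ∈ Finset.Icc 1 P.T, P.surrogateLip x P.T ^ 2 :=
          Finset.sum_le_sum_of_subset_of_nonneg (Finset.filter_subset _ _)
            fun _ _ _ => sq_nonneg _
      _ = _ := by simp
  rw [← Real.sqrt_sq hL, ← Real.sqrt_mul (by positivity)]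
  exact Real.sqrt_le_sqrt hle

open Classical in
/-- The choice `λ = 1 / (2 √T)`, for which `√T Φ'(Q) = exp (λ Q) / 2`, lets the potential absorb
the part of the gradient bound that depends on the violation. -/
theorem IsSwitchRun.exp_add_regret_le (h : P.Standing) (hD : 0 < P.D) (hT : 2 ≤ P.T)
    {x y p : ℕ → EuclideanSpace ℝ (Fin d)} (hr : P.IsSwitchRun x y p)
    {u : EuclideanSpace ℝ (Fin d)} (hu : u ∈ P.S P.T) :
    1 / 2 * Real.exp (1 / (2 * √(P.T : ℝ)) * P.scaledCCV x P.T) +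
        P.β * ∑ s ∈ Finset.Icc 1 P.T with ¬ P.FirstPhase x s, (P.f s (x s) - P.f s u) ≤
      1 + √(P.T : ℝ) := by
  have hG := h.G_pos
  have h1 := (potential_add_regret_le x hu).trans (hr.surrogate_regret h hD hu.1)
  have h2 := hr.sqrt_sum_norm_sq_le h
  have hT0 : 0 < √(P.T : ℝ) := Real.sqrt_pos.2 (by exact_mod_cast (by omega : 0 < P.T))
  set e := Real.exp (1 / (2 * √(P.T : ℝ)) * P.scaledCCV x P.T) with he
  have he0 : 0 < e := Real.exp_pos _
  have h3 : √2 * P.D * (√(P.T : ℝ) * P.surrogateLip x P.T) =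
      √2 / 2 * (√(P.T : ℝ) + e / 2) := by
    rw [surrogateLip, deriv_Φ, ← he, β]
    field_simp
  have h4 : √2 / 2 ≤ (1 : ℝ) := by
    have : √2 ≤ (2 : ℝ) := Real.sqrt_le_iff.2 ⟨by norm_num, by norm_num⟩
    linarith
  have h5 : √2 / 2 * (√(P.T : ℝ) + e / 2) ≤ √(P.T : ℝ) + e / 2 :=
    mul_le_of_le_one_left (by positivity) h4
  have h6 : √2 * P.D * √(∑ s ∈ Finset.Icc 1 P.T with ¬ P.FirstPhase x s, ‖p s‖ ^ 2) ≤
      √2 * P.D * (√(P.T : ℝ) * P.surrogateLip x P.T) := by gcongr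
  have h7 : P.Φ (P.scaledCCV x P.T) = e - 1 := rfl
  linarith

open Classical in
theorem IsSwitchRun.regret_second (h : P.Standing) (hD : 0 < P.D) (hT : 2 ≤ P.T)
    {x y p : ℕ → EuclideanSpace ℝ (Fin d)} (hr : P.IsSwitchRun x y p)
    {u : EuclideanSpace ℝ (Fin d)} (hu : u ∈ P.S P.T) :
    ∑ s ∈ Finset.Icc 1 P.T with ¬ P.FirstPhase x s, (P.f s (x s) - P.f s u) ≤
      2 * (P.G * P.D) * (1 + √(P.T : ℝ)) := by
  have hG := h.G_pos
  have h1 := hr.exp_add_regret_le h hD hT hu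
  have he := Real.exp_pos (1 / (2 * √(P.T : ℝ)) * P.scaledCCV x P.T)
  set R := ∑ s ∈ Finset.Icc 1 P.T with ¬ P.FirstPhase x s, (P.f s (x s) - P.f s u)
  have h2 : P.β * R ≤ 1 + √(P.T : ℝ) := by linarith
  calc R = 2 * (P.G * P.D) * (P.β * R) := by rw [β]; field_simp
    _ ≤ _ := by gcongr

open Classical in
/-- Regret is at least `-G D T`, so that the exponential of the scaled violation is polynomial
in `T`. -/
theorem IsSwitchRun.violation_second (h : P.Standing) (hD : 0 < P.D) (hT : 2 ≤ P.T)
    {x y p : ℕ → EuclideanSpace ℝ (Fin d)} (hr : P.IsSwitchRun x y p) :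
    ∑ s ∈ Finset.Icc 1 P.T with ¬ P.FirstPhase x s, max (P.g s (x s)) 0 ≤
      12 * (P.G * P.D) * (√(P.T : ℝ) * Real.log P.T) := by
  have hG := h.G_pos
  obtain ⟨u, hu⟩ := h.feasible
  have h1 := hr.exp_add_regret_le h hD hT hu
  have hT2 : (2 : ℝ) ≤ P.T := by exact_mod_cast hT
  have hT0 : 0 < √(P.T : ℝ) := Real.sqrt_pos.2 (by linarith)
  set Q := P.scaledCCV x P.T with hQ
  have hsum : ∑ s ∈ Finset.Icc 1 P.T with ¬ P.FirstPhase x s, max (P.g s (x s)) 0 =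
      2 * (P.G * P.D) * Q := by
    rw [hQ, scaledCCV, ← Finset.mul_sum, β]
    simp_rw [max_comm (0 : ℝ)]
    field_simp
  have hreg : -(P.G * P.D * P.T) ≤
      ∑ s ∈ Finset.Icc 1 P.T with ¬ P.FirstPhase x s, (P.f s (x s) - P.f s u) := by
    have h3 : ∑ s ∈ Finset.Icc 1 P.T with ¬ P.FirstPhase x s, (-(P.f s (x s) - P.f s u)) ≤
        ∑ s ∈ Finset.Icc 1 P.T, P.G * P.D := by
      refine (Finset.sum_le_sum fun s hs => ?_).trans (Finset.sum_le_sum_of_subset_of_nonneg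
        (Finset.filter_subset (fun s => ¬ P.FirstPhase x s) (Finset.Icc 1 P.T))
        fun _ _ _ => by positivity)
      have hs := (Finset.mem_filter.1 hs).1
      have h4 := (abs_le.1 (h.lipschitz_f s hs _ (hr.mem_X hs) u hu.1)).1
      have h5 := mul_le_mul_of_nonneg_left (h.norm_sub_le (hr.mem_X hs) hu.1) hG.le
      linarith
    rw [Finset.sum_neg_distrib] at h3
    simp only [Finset.sum_const, Nat.card_Icc, Nat.add_sub_cancel, nsmul_eq_mul] at h3
    linarith
  have hβreg : -(P.T / 2 : ℝ) ≤
      P.β * ∑ s ∈ Finset.Icc 1 P.T with ¬ P.FirstPhase x s, (P.f s (x s) - P.f s u) := by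
    calc -(P.T / 2 : ℝ) = P.β * (-(P.G * P.D * P.T)) := by rw [β]; field_simp
      _ ≤ _ := mul_le_mul_of_nonneg_left hreg h.β_nonneg
  have hsqrt : √(P.T : ℝ) ≤ P.T := Real.sqrt_le_iff.2 ⟨by linarith, by nlinarith⟩
  have hexp : Real.exp (1 / (2 * √(P.T : ℝ)) * Q) ≤ (P.T : ℝ) ^ 3 := by
    have : (4 : ℝ) * P.T ≤ P.T ^ 3 := by nlinarith [mul_self_nonneg ((P.T : ℝ) - 2)]
    linarith
  have hlog : 1 / (2 * √(P.T : ℝ)) * Q ≤ 3 * Real.log P.T := by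
    have := Real.log_le_log (Real.exp_pos _) hexp
    rwa [Real.log_exp, Real.log_pow] at this
  rw [hsum]
  calc 2 * (P.G * P.D) * Q
      = 4 * (P.G * P.D) * √(P.T : ℝ) * (1 / (2 * √(P.T : ℝ)) * Q) := by field_simp; ring
    _ ≤ 4 * (P.G * P.D) * √(P.T : ℝ) * (3 * Real.log P.T) := by gcongr
    _ = _ := by ring

end COCO

/-! ### Both phases together -/

namespace COCO

variable {P : COCO d}

/-- The last round `τ` of the first phase. -/
theorem exists_last_firstPhase (hT : 2 ≤ P.T) (x : ℕ → EuclideanSpace ℝ (Fin d)) :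
    ∃ τ ∈ Finset.Icc 1 P.T, P.FirstPhase x τ ∧ (τ = P.T ∨ ¬ P.FirstPhase x (τ + 1)) := by
  classical
  refine ⟨Nat.findGreatest (P.FirstPhase x) P.T, Finset.mem_Icc.2 ⟨?_, Nat.findGreatest_le _⟩,
    Nat.findGreatest_spec (m := 1) (by omega) (firstPhase_one x), ?_⟩
  · exact Nat.le_findGreatest (by omega) (firstPhase_one x)
  · by_cases hτ : Nat.findGreatest (P.FirstPhase x) P.T = P.T
    · exact Or.inl hτ
    · refine Or.inr (Nat.findGreatest_is_greatest (Nat.lt_succ_self _) ?_)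
      have := Nat.findGreatest_le (P := P.FirstPhase x) P.T
      omega

open Classical in
theorem sum_split_phases {x : ℕ → EuclideanSpace ℝ (Fin d)} {τ : ℕ}
    (hτ : τ ∈ Finset.Icc 1 P.T) (h1 : P.FirstPhase x τ)
    (h2 : τ = P.T ∨ ¬ P.FirstPhase x (τ + 1)) (F : ℕ → ℝ) :
    ∑ s ∈ Finset.Icc 1 P.T, F s = ∑ s ∈ Finset.Icc 1 τ, F s +
      ∑ s ∈ Finset.Icc 1 P.T with ¬ P.FirstPhase x s, F s := by
  rw [← Finset.sum_filter_add_sum_filter_not _ (fun s => P.FirstPhase x s)]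
  congr 2
  ext s
  rw [Finset.mem_filter, Finset.mem_Icc, Finset.mem_Icc]
  rw [Finset.mem_Icc] at hτ
  constructor
  · rintro ⟨hs, hfp⟩
    refine ⟨hs.1, ?_⟩
    by_contra! hlt
    rcases h2 with rfl | h2
    · omega
    · exact h2 (hfp.of_le hlt)
  · rintro hs
    exact ⟨⟨hs.1, hs.2.trans hτ.2⟩, h1.of_le hs.2⟩

theorem one_le_two_mul_sqrt_mul_log (hT : 2 ≤ P.T) :
    1 ≤ 2 * (√(P.T : ℝ) * Real.log P.T) := by
  have hT2 : (2 : ℝ) ≤ P.T := by exact_mod_cast hT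
  have h1 : 1 ≤ √(P.T : ℝ) := Real.one_le_sqrt.2 (by linarith)
  have h2 : 1 / 2 ≤ Real.log P.T := by
    have := Real.log_two_gt_d9
    have := Real.log_le_log (by norm_num) hT2
    linarith
  nlinarith

theorem IsSwitchRun.regret_le (h : P.Standing) (hD : 0 < P.D) (hT : 2 ≤ P.T)
    {x y p : ℕ → EuclideanSpace ℝ (Fin d)} (hr : P.IsSwitchRun x y p)
    {u : EuclideanSpace ℝ (Fin d)} (hu : u ∈ P.S P.T) :
    P.regret x u ≤ 6 * (P.G * P.D * √(P.T : ℝ)) := by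
  classical
  have hG := h.G_pos
  obtain ⟨τ, hτ, h1, h2⟩ := exists_last_firstPhase hT x
  have hT1 : 1 ≤ √(P.T : ℝ) := Real.one_le_sqrt.2 (by exact_mod_cast (by omega : 1 ≤ P.T))
  have hfirst := hr.regret_first h hD hu hτ h1
  have hsecond := hr.regret_second h hD hT hu
  have hτT : √(τ : ℝ) ≤ √(P.T : ℝ) :=
    Real.sqrt_le_sqrt (by exact_mod_cast (Finset.mem_Icc.1 hτ).2)
  have h3 : P.G * P.D * √(τ : ℝ) ≤ P.G * P.D * √(P.T : ℝ) := by gcongr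
  have h4 : P.G * P.D * 1 ≤ P.G * P.D * √(P.T : ℝ) := by gcongr
  have h5 : 0 ≤ P.G * P.D * √(P.T : ℝ) := by positivity
  rw [regret, ← Finset.sum_sub_distrib, sum_split_phases hτ h1 h2]
  linarith

/-- The violation of both phases. The last round of the first phase may exceed the threshold by
one Lipschitz step. -/
theorem IsSwitchRun.ccv_le_sqrt_mul_log (h : P.Standing) (hD : 0 < P.D) (hT : 2 ≤ P.T)
    {x y p : ℕ → EuclideanSpace ℝ (Fin d)} (hr : P.IsSwitchRun x y p) :
    P.ccv x P.T ≤ 14 * (1 + P.G * P.D) * (√(P.T : ℝ) * Real.log P.T) := by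
  classical
  have hG := h.G_pos
  obtain ⟨τ, hτ, h1, h2⟩ := exists_last_firstPhase hT x
  have hsecond := hr.violation_second h hD hT
  have hL := one_le_two_mul_sqrt_mul_log hT
  have hfirst : P.ccv x τ ≤ √(P.T : ℝ) * Real.log P.T + P.G * P.D := by
    obtain ⟨n, rfl⟩ : ∃ n, τ = n + 1 := ⟨τ - 1, by have := (Finset.mem_Icc.1 hτ).1; omega⟩
    obtain ⟨z, hz⟩ := h.nonempty_S (Finset.mem_Icc.1 hτ).2
    have h3 : P.ccv x n ≤ √(P.T : ℝ) * Real.log P.T := h1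
    have h4 := h.violation_le hτ (hr.mem_X hτ) hz
    have h5 := mul_le_mul_of_nonneg_left (h.norm_sub_le (hr.mem_X hτ) hz.1) hG.le
    rw [ccv_succ]
    linarith
  have hsplit : P.ccv x P.T = P.ccv x τ +
      ∑ s ∈ Finset.Icc 1 P.T with ¬ P.FirstPhase x s, max (P.g s (x s)) 0 :=
    sum_split_phases hτ h1 h2 _
  have h6 : P.G * P.D * 1 ≤ P.G * P.D * (2 * (√(P.T : ℝ) * Real.log P.T)) := by gcongr
  rw [hsplit]
  linarith

/-- If the algorithm switches, its first phase has already violated more than `√T log T`, so that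
the instance-dependent bound on the first phase bounds `√T log T` as well. -/
theorem IsSwitchRun.ccv_le_cStar (h : P.Standing) (hD : 0 < P.D) (hT : 2 ≤ P.T)
    {x y p : ℕ → EuclideanSpace ℝ (Fin d)} (hr : P.IsSwitchRun x y p) :
    P.ccv x P.T ≤ 84 * (1 + P.G * P.D) *
      (P.G * (√(d : ℝ) * (1 / P.cStar x) ^ d * P.D)) := by
  have hG := h.G_pos
  have hc := hr.cStar_pos h
  obtain ⟨τ, hτ, h1, h2⟩ := exists_last_firstPhase hT x
  have hfirst := hr.ccv_le_of_firstPhase h (Finset.mem_Icc.1 hτ).2 h1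
  set B := P.G * (√(d : ℝ) * (1 / P.cStar x) ^ d * P.D)
  have hB : 0 ≤ B := by positivity
  have hpi : √(2 * Real.pi) ≤ 3 := Real.sqrt_le_iff.2
    ⟨by norm_num, by have := Real.pi_lt_d2; linarith⟩
  have hfirst' : P.ccv x τ ≤ 6 * B := by
    refine hfirst.trans ?_
    gcongr
    linarith
  have hGD : 0 ≤ P.G * P.D := by positivity
  rcases h2 with rfl | h2
  · nlinarith [mul_nonneg hGD hB]
  · have h3 : √(P.T : ℝ) * Real.log P.T < P.ccv x τ := not_le.1 h2
    calc P.ccv x P.T ≤ 14 * (1 + P.G * P.D) * (√(P.T : ℝ) * Real.log P.T) :=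
          hr.ccv_le_sqrt_mul_log h hD hT
      _ ≤ 14 * (1 + P.G * P.D) * (6 * B) := by
          exact mul_le_mul_of_nonneg_left (h3.le.trans hfirst') (by positivity)
      _ = _ := by ring

/-- If the admissible set is a single point, then that point is feasible and every action. -/
theorem IsSwitchRun.regret_eq_zero_and_ccv_eq_zero (h : P.Standing) (hD : P.D = 0)
    {x y p : ℕ → EuclideanSpace ℝ (Fin d)} (hr : P.IsSwitchRun x y p) :
    (∀ u ∈ P.S P.T, P.regret x u = 0) ∧ P.ccv x P.T = 0 := by
  have heq : ∀ t ∈ Finset.Icc 1 P.T, ∀ u ∈ P.S P.T, x t = u := by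
    intro t ht u hu
    have := h.norm_sub_le (hr.mem_X ht) hu.1
    rw [hD] at this
    exact sub_eq_zero.1 (norm_le_zero_iff.1 this)
  constructor
  · intro u hu
    rw [regret, sub_eq_zero]
    exact Finset.sum_congr rfl fun t ht => by rw [heq t ht u hu]
  · obtain ⟨u, hu⟩ := h.feasible
    exact Finset.sum_eq_zero fun t ht => by
      rw [heq t ht u hu]
      exact max_eq_right (hu.2 t ht)

end COCO

end

theorem mainTheorem2 :
    ∃ C : ℝ, 0 < C ∧ ∀ (d : ℕ) (P : COCO d), P.Standing → 2 ≤ P.T →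
      ∀ x y p : ℕ → EuclideanSpace ℝ (Fin d), P.IsSwitchRun x y p →
        (∀ u ∈ P.S P.T, P.regret x u ≤ C * (P.G * P.D * √(P.T : ℝ))) ∧
        P.ccv x P.T ≤ min
          (C * (1 + P.G * P.D) * (P.G * (√(d : ℝ) * (1 / P.cStar x) ^ d * P.D)))
          (C * (1 + P.G * P.D) * (√(P.T : ℝ) * Real.log P.T)) := by
  -- `84 = 14 * 6`, where `2 * √(2 * π) ≤ 6`
  refine ⟨84, by norm_num, fun d P h hT x y p hr => ?_⟩
  have hG := h.G_pos
  have hlog : 0 ≤ √(P.T : ℝ) * Real.log P.T :=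
    mul_nonneg (Real.sqrt_nonneg _) (Real.log_natCast_nonneg _)
  obtain hD | hD := (COCO.D_nonneg (P := P)).eq_or_lt
  · obtain ⟨hreg, hccv⟩ := hr.regret_eq_zero_and_ccv_eq_zero h hD.symm
    rw [← hD, hccv]
    refine ⟨fun u hu => by simp [hreg u hu], le_min ?_ ?_⟩
    · simp
    · rw [mul_zero]
      linarith
  · refine ⟨fun u hu => (hr.regret_le h hD hT hu).trans ?_,
      le_min (hr.ccv_le_cStar h hD hT) ((hr.ccv_le_sqrt_mul_log h hD hT).trans ?_)⟩
    · gcongr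
      norm_num
    · gcongr
      norm_num
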